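/- **Setting.** Let $p>0$, $b<d$, $k>0$, $\theta\in(-\pi/2,\pi/2)$, $\hat\alpha=k\sin\theta$, and for $n\in\mathbb Z$ let $\alpha_n=\hat\alpha+\frac{2\pi}{p}n$, and $\beta_n=\sqrt{k^2-\alpha_n^2}$ if $\alpha_n^2\le k^2$, $\beta_n=i\sqrt{\alpha_n^2-k^2}$ otherwise. Let $\tilde q=1$ for $x_2>d$, $\tilde q=q_0(x_1,x_2)$ for $b<x_2<d$ and $\tilde q=q(x_2)$ for $x_2<b$, where $q_0\in L^\infty(\mathbb R\times(b,d);\mathbb C)$ is $p$-periodic in $x_1$ with $\operatorname{Im}q_0\ge 0$ and $\operatorname{Re}q_0>0$, and $q\in L^\infty(\mathbb R;\mathbb R)$ is positive and $2\pi$-periodic. *Downward modes.* Let $w_{n,1},w_{n,2}$ be the solutions of $u''+(k^2q-\alpha_n^2)u=0$ on $\mathbb R$ with $w_{n,1}(0)=w_{n,2}'(0)=1$, $w_{n,1}'(0)=w_{n,2}(0)=0$. Put $$W_n=\begin{pmatrix}w_{n,1}(2\pi)&w_{n,2}(2\pi)\\ w_{n,1}'(2\pi)&w_{n,2}'(2\pi)\end{pmatrix},\qquad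 \eta_n=\operatorname{tr}W_n .$$ Assume (Assumption A) that $W_n\ne I$ whenever $\eta_n=2$ and $W_n\neq -I$ whenever $\eta_n=-2$. The $n$-th downward mode $u_n^-$ is the nontrivial solution, unique up to a constant factor, of the form $u_n^-(t)=e^{m_nt}v_n(t)$ with $v_n$ $2\pi$-periodic, where: $m_n=\mu>0$ with $e^{2\pi\mu}$ an eigenvalue of $W_n$ if $\eta_n>2$; $m_n=\mu+\frac i2$, $\mu>0$, with $-e^{2\pi\mu}$ an eigenvalue of $W_n$ if $\eta_n<-2$; $m_n=-i\vartheta$, $\vartheta\in(0,\frac12)$, with $e^{2\pi i\vartheta}$ an eigenvalue of $W_n$ if $|\eta_n|<2$; $m_n=0$ if $\eta_n=2$; $m_n=\frac i2$ if $\eta_n=-2$. Assume $u_n^-(b)\ne 0$ for all $n$, and put $\tau_n=-(u_n^-)'(b)/u_n^-(b)$. *The form.* Let $C=(0,p)\times(b,d)$, and let $H^1_{\hat\alpha}(C)$ be the space of the (restrictions to $C$ of) functions $u$ on $\mathbb R\times(b,d)$ such that $e^{-i\hat\alpha x_1}u$ is $p$-periodic in $x_1$ and $u$ has a weak gradient there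 with $u,\nabla u\in L^2(C)$, with norm $(\|u\|_{L^2(C)}^2+\|\nabla u\|_{L^2(C)}^2)^{1/2}$. Let $u_n(d)$, $u_n(b)$ be the coefficients of the traces $u(x_1,d)=\sum_n u_n(d)e^{i\alpha_nx_1}$ and $u(x_1,b)=\sum_n u_n(b)e^{i\alpha_nx_1}$. The upward and downward Dirichlet-to-Neumann maps are $T\sum_n f_ne^{i\alpha_nx_1}=\sum_n i\beta_nf_ne^{i\alpha_nx_1}$ on $x_2=d$ and $T^-\sum_n f_ne^{i\alpha_nx_1}=\sum_n\tau_nf_ne^{i\alpha_nx_1}$ on $x_2=b$. Consider $$a(u,v)=\int_C\big(\nabla u\cdot\nabla\bar v-k^2\tilde q\,u\bar v\big)\,dx-\int_0^p Tu\,\bar v\,ds\Big|_{x_2=d}-\int_0^p T^-u\,\bar v\,ds\Big|_{x_2=b},$$ the boundary integrals denoting the dualities $p\sum_n i\beta_nu_n(d)\overline{v_n(d)}$ and $p\sum_n\tau_nu_n(b)\overline{v_n(b)}$. **Theorem.** These series converge absolutely for all $u,v\in H^1_{\hat\alpha}(C)$, and the sesquilinear form $a$ on $H^1_{\hat\alpha}(C)\times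 H^1_{\hat\alpha}(C)$ is strongly elliptic, i.e. $a=B-Q$ with a bounded sesquilinear form $B$ that is coercive ($\operatorname{Re}B(u,u)\ge c\|u\|^2$ for all $u$, with some $c>0$) and a bounded sesquilinear form $Q$ that is compact ($u\mapsto Q(u,\cdot)$ is a compact operator into the antidual). More precisely, there is $N\in\mathbb N$ such that $\tau_n$ is real and negative for all $|n|>N$ and such that $$B(u,v)=\int_C\big(\nabla u\cdot\nabla\bar v+u\bar v\big)\,dx-p\sum_n i\beta_nu_n(d)\overline{v_n(d)}-p\sum_{|n|>N}\tau_nu_n(b)\overline{v_n(b)},$$ $$Q(u,v)=\int_C(k^2\tilde q+1)\,u\bar v\,dx+p\sum_{|n|\le N}\tau_nu_n(b)\overline{v_n(b)}$$ are, respectively, coercive and compact (both bounded), with $a=B-Q$. -/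

import Mathlib

open MeasureTheory Filter
open scoped ComplexConjugate ContDiff

noncomputable section

/-- The data of the diffraction problem with its standing assumptions: a homogeneous cover
`x₂ > d`, a grating `b < x₂ < d` of horizontal period `p` and index `q₀`, and a substrate
`x₂ < b` whose real index `q` depends on `x₂` only and is `2π`-periodic (`q` is extended
periodically to `ℝ`); `k` is the wavenumber and `θ` the angle of incidence. -/
structure GratingProblem where
  p : ℝ
  b : ℝ
  d : ℝ
  k : ℝ
  θ : ℝ
  q : ℝ → ℝ
  q₀ : ℝ × ℝ → ℂ
  p_pos : 0 < p
  b_lt_d : b < d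
  k_pos : 0 < k
  θ_mem : θ ∈ Set.Ioo (-(Real.pi / 2)) (Real.pi / 2)
  q_periodic : Function.Periodic q (2 * Real.pi)
  q_bounded : MemLp q ⊤ volume
  q_pos : ∀ᵐ t : ℝ, 0 < q t
  q₀_periodic : ∀ x₁ x₂ : ℝ, x₂ ∈ Set.Ioo b d → q₀ (x₁ + p, x₂) = q₀ (x₁, x₂)
  q₀_bounded : MemLp q₀ ⊤ (volume.restrict (Set.univ ×ˢ Set.Ioo b d))
  q₀_im_nonneg : ∀ᵐ x ∂(volume.restrict (Set.univ ×ˢ Set.Ioo b d)), 0 ≤ (q₀ x).im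
  q₀_re_pos : ∀ᵐ x ∂(volume.restrict (Set.univ ×ˢ Set.Ioo b d)), 0 < (q₀ x).re

/-! ### Traces on horizontal lines and Fourier coefficients -/

/-- The trace on `x₂ = d` of a function `u` on `b < x₂ < d` with weak derivative `g = ∂₂u`:
`(d - b) u(x₁, d) = ∫_b^d ∂₂((t - b) u(x₁, t)) dt`.  The right-hand side depends continuously on
`(u, g)` in `L²`, and it is the restriction of `u` when `u` is smooth up to the boundary
(`traceAbove_eq`), so this is the usual trace operator. -/
def traceAbove (b d : ℝ) (u g : ℝ × ℝ → ℂ) (x₁ : ℝ) : ℂ :=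
  ((d - b : ℝ) : ℂ)⁻¹ * ∫ t in b..d, (u (x₁, t) + ((t - b : ℝ) : ℂ) * g (x₁, t))

/-- The trace on `x₂ = b`: `(d - b) u(x₁, b) = ∫_b^d ∂₂((t - d) u(x₁, t)) dt`. -/
def traceBelow (b d : ℝ) (u g : ℝ × ℝ → ℂ) (x₁ : ℝ) : ℂ :=
  ((d - b : ℝ) : ℂ)⁻¹ * ∫ t in b..d, (u (x₁, t) + ((t - d : ℝ) : ℂ) * g (x₁, t))

theorem integral_shift_mul_deriv (b d c : ℝ) (f g : ℝ → ℂ)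
    (hf : ∀ t, HasDerivAt f (g t) t) (hg : Continuous g) :
    ∫ t in b..d, (f t + ((t - c : ℝ) : ℂ) * g t)
      = ((d - c : ℝ) : ℂ) * f d - ((b - c : ℝ) : ℂ) * f b := by
  have hc : Continuous f := continuous_iff_continuousAt.2 fun t => (hf t).continuousAt
  refine intervalIntegral.integral_eq_sub_of_hasDerivAt
    (f := fun t => ((t - c : ℝ) : ℂ) * f t) (fun t _ => ?_)
    (Continuous.intervalIntegrable (by fun_prop) b d)
  have h1 : HasDerivAt (fun s : ℝ => ((s - c : ℝ) : ℂ)) ((1 : ℝ) : ℂ) t :=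
    ((hasDerivAt_id t).sub_const c).ofReal_comp
  have h2 : HasDerivAt (fun s : ℝ => ((s - c : ℝ) : ℂ) * f s)
      (((1 : ℝ) : ℂ) * f t + ((t - c : ℝ) : ℂ) * g t) t := h1.mul (hf t)
  rwa [Complex.ofReal_one, one_mul] at h2

theorem traceAbove_eq {b d : ℝ} (hbd : b < d) (u g : ℝ × ℝ → ℂ) (x₁ : ℝ)
    (hu : ∀ t, HasDerivAt (fun s => u (x₁, s)) (g (x₁, t)) t)
    (hg : Continuous fun t => g (x₁, t)) :
    traceAbove b d u g x₁ = u (x₁, d) := by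
  have h0 : ((d - b : ℝ) : ℂ) ≠ 0 := by exact_mod_cast (sub_pos.2 hbd).ne'
  rw [traceAbove, integral_shift_mul_deriv b d b _ _ hu hg, sub_self, Complex.ofReal_zero,
    zero_mul, sub_zero, inv_mul_cancel_left₀ h0]

theorem traceBelow_eq {b d : ℝ} (hbd : b < d) (u g : ℝ × ℝ → ℂ) (x₁ : ℝ)
    (hu : ∀ t, HasDerivAt (fun s => u (x₁, s)) (g (x₁, t)) t)
    (hg : Continuous fun t => g (x₁, t)) :
    traceBelow b d u g x₁ = u (x₁, b) := by
  have h0 : ((d - b : ℝ) : ℂ) ≠ 0 := by exact_mod_cast (sub_pos.2 hbd).ne'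
  rw [traceBelow, integral_shift_mul_deriv b d d _ _ hu hg, sub_self, Complex.ofReal_zero,
    zero_mul, zero_sub, ← neg_mul, ← Complex.ofReal_neg, neg_sub, inv_mul_cancel_left₀ h0]

/-! ### Hill's equation -/

/-- `u'' + V u = 0` on `ℝ` in the sense of Carathéodory: `u` is differentiable and `u'` is an
indefinite integral of `-V u` (so `u` is `C¹`, and the equation holds almost everywhere). -/
def IsHillSolution {E : Type} [NormedAddCommGroup E] [NormedSpace ℝ E]
    (V : ℝ → ℝ) (u : ℝ → E) : Prop :=
  Differentiable ℝ u ∧ ∀ x, deriv u x = deriv u 0 - ∫ t in (0 : ℝ)..x, V t • u t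

/-- The solution of `u'' + V u = 0`, `u(0) = a₀`, `u'(0) = a₁`. -/
def hillSolution (V : ℝ → ℝ) (a₀ a₁ : ℝ) : ℝ → ℝ :=
  Classical.epsilon fun w => IsHillSolution V w ∧ w 0 = a₀ ∧ deriv w 0 = a₁

/-! ### Forms on a Hilbert space -/

section Forms

variable {H : Type} [NormedAddCommGroup H] [InnerProductSpace ℂ H]

/-- `B` is a bounded sesquilinear form (linear in the first, conjugate linear in the second
argument) with `Re B(u, u) ≥ c ‖u‖²` for some `c > 0`. -/
def IsCoerciveForm (B : H → H → ℂ) : Prop :=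
  (∃ B' : H →L[ℂ] H →L⋆[ℂ] ℂ, ∀ u v, B u v = B' u v) ∧
    ∃ c : ℝ, 0 < c ∧ ∀ u, c * ‖u‖ ^ 2 ≤ (B u u).re

/-- `Q` is a compact sesquilinear form: a bounded one for which `u ↦ Q(u, ·)` is a compact
operator from `H` to its antidual. -/
def IsCompactForm (Q : H → H → ℂ) : Prop :=
  ∃ Q' : H →L[ℂ] H →L⋆[ℂ] ℂ, (∀ u v, Q u v = Q' u v) ∧ IsCompactOperator Q'

/-- A form is strongly elliptic if it is a coercive form minus a compact form. -/
def IsStronglyElliptic (a : H → H → ℂ) : Prop :=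
  ∃ B Q : H → H → ℂ, IsCoerciveForm B ∧ IsCompactForm Q ∧ ∀ u v, a u v = B u v - Q u v

end Forms

namespace GratingProblem

variable (S : GratingProblem)

/-- The refractive index `q̃` of the whole plane. -/
def refractiveIndex (x : ℝ × ℝ) : ℂ :=
  if S.d < x.2 then 1 else if S.b < x.2 then S.q₀ x else (S.q x.2 : ℂ)

/-- `α̂ = k sin θ`. -/
def αhat : ℝ := S.k * Real.sin S.θ

/-- `αₙ = α̂ + 2πn/p`. -/
def α (n : ℤ) : ℝ := S.αhat + 2 * Real.pi / S.p * n

/-- `βₙ = √(k² - αₙ²)`, with non-negative imaginary part. -/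
def β (n : ℤ) : ℂ :=
  if S.α n ^ 2 ≤ S.k ^ 2 then (Real.sqrt (S.k ^ 2 - S.α n ^ 2) : ℂ)
  else Complex.I * (Real.sqrt (S.α n ^ 2 - S.k ^ 2) : ℂ)

/-- The coefficients `fₙ` in `f(x₁) = ∑ₙ fₙ exp(i αₙ x₁)`. -/
def fourierCoefficient (f : ℝ → ℂ) (n : ℤ) : ℂ :=
  ((1 / S.p : ℝ) : ℂ) * ∫ x in (0 : ℝ)..S.p, f x * Complex.exp (-(Complex.I * S.α n * x))

/-! ### Wave modes in the substrate -/

/-- The potential `k² q - αₙ²` of the `n`-th Hill equation. -/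
def hillPotential (n : ℤ) (t : ℝ) : ℝ := S.k ^ 2 * S.q t - S.α n ^ 2

def w₁ (n : ℤ) : ℝ → ℝ := hillSolution (S.hillPotential n) 1 0

def w₂ (n : ℤ) : ℝ → ℝ := hillSolution (S.hillPotential n) 0 1

/-- The monodromy matrix `Wₙ`. -/
def monodromy (n : ℤ) : Matrix (Fin 2) (Fin 2) ℝ :=
  !![S.w₁ n (2 * Real.pi), S.w₂ n (2 * Real.pi);
     deriv (S.w₁ n) (2 * Real.pi), deriv (S.w₂ n) (2 * Real.pi)]

/-- `ηₙ = wₙ₁(2π) + wₙ₂'(2π)`. -/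
def η (n : ℤ) : ℝ := S.w₁ n (2 * Real.pi) + deriv (S.w₂ n) (2 * Real.pi)

/-- The characteristic multipliers are the eigenvalues of the monodromy matrix. -/
def IsCharacteristicMultiplier (n : ℤ) (l : ℂ) : Prop :=
  Module.End.HasEigenvalue (Matrix.toLin' ((S.monodromy n).map Complex.ofReal)) l

/-- The exponent `m` of the `n`-th downward mode `exp(m x₂) v(x₂)`, `v` being `2π`-periodic. -/
def IsDownwardExponent (n : ℤ) (m : ℂ) : Prop :=
  (2 < S.η n ∧ ∃ μ : ℝ, 0 < μ ∧
    S.IsCharacteristicMultiplier n (Real.exp (2 * Real.pi * μ) : ℂ) ∧ m = μ) ∨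
  (S.η n < -2 ∧ ∃ μ : ℝ, 0 < μ ∧
    S.IsCharacteristicMultiplier n (-(Real.exp (2 * Real.pi * μ) : ℂ)) ∧ m = μ + Complex.I / 2) ∨
  (|S.η n| < 2 ∧ ∃ ϑ : ℝ, 0 < ϑ ∧ ϑ < 1 / 2 ∧
    S.IsCharacteristicMultiplier n (Complex.exp (Complex.I * (2 * Real.pi * ϑ))) ∧
    m = -(Complex.I * ϑ)) ∨
  (S.η n = 2 ∧ m = 0) ∨
  (S.η n = -2 ∧ m = Complex.I / 2)

/-- `u` is an `n`-th downward mode: a nontrivial Floquet solution `u(t) = exp(m t) v(t)` of the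
`n`-th Hill equation with the downward exponent `m`.  If `ηₙ ≠ ±2`, or if `Wₙ ≠ ±I`, it is
unique up to a constant factor. -/
def IsDownwardMode (n : ℤ) (u : ℝ → ℂ) : Prop :=
  u ≠ 0 ∧ IsHillSolution (S.hillPotential n) u ∧
    ∃ (m : ℂ) (v : ℝ → ℂ), S.IsDownwardExponent n m ∧ Function.Periodic v (2 * Real.pi) ∧
      ∀ t : ℝ, u t = Complex.exp (m * t) * v t

/-- The `n`-th downward mode `uₙ⁻` (a choice of the constant factor is immaterial below). -/
def downwardMode (n : ℤ) : ℝ → ℂ := Classical.epsilon (S.IsDownwardMode n)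

/-- The two exceptional cases `ηₙ = 2`, `Wₙ = I` and `ηₙ = -2`, `Wₙ = -I` do not occur. -/
def AssumptionA : Prop :=
  ∀ n : ℤ, (S.η n = 2 → (S.monodromy n - 1).rank ≠ 0) ∧
    (S.η n = -2 → (S.monodromy n + 1).rank ≠ 0)

/-! ### Dirichlet-to-Neumann maps

A quasi-periodic distribution `∑ₙ fₙ exp(i αₙ x₁)` is represented by its coefficients `n ↦ fₙ`. -/

/-- The classical upward map `T` on `x₂ = d`. -/
def T (f : ℤ → ℂ) (n : ℤ) : ℂ := Complex.I * S.β n * f n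

/-- The `n`-th coefficient `-(uₙ⁻)'(b) / uₙ⁻(b)` of the downward map. -/
def downwardCoefficient (n : ℤ) : ℂ := -(deriv (S.downwardMode n) S.b / S.downwardMode n S.b)

/-- The downward map `T⁻` on `x₂ = b`. -/
def Tminus (f : ℤ → ℂ) (n : ℤ) : ℂ := S.downwardCoefficient n * f n

/-- The part of `T⁻` with modes `|n| > N`. -/
def TminusHigh (N : ℕ) (f : ℤ → ℂ) (n : ℤ) : ℂ := if (N : ℤ) < |n| then S.Tminus f n else 0

/-- The part of `T⁻` with modes `|n| ≤ N`. -/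
def TminusLow (N : ℕ) (f : ℤ → ℂ) (n : ℤ) : ℂ := if (N : ℤ) < |n| then 0 else S.Tminus f n

/-- The duality `∫₀ᵖ F ḡ ds` in terms of coefficients. -/
def pairing (F g : ℤ → ℂ) : ℂ := S.p * ∑' n : ℤ, F n * conj (g n)

/-! ### The quasi-periodic Sobolev space -/

/-- The periodic cell `C = (0, p) × (b, d)`. -/
def cell : Set (ℝ × ℝ) := Set.Ioo 0 S.p ×ˢ Set.Ioo S.b S.d

/-- Test functions for `α̂`-quasi-periodic distributions on `b < x₂ < d`: smooth functions whose
support in `x₂` is a compact part of `(b, d)` and which acquire the factor `exp(-i α̂ p)` under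
`x₁ ↦ x₁ + p`, so that their product with an `α̂`-quasi-periodic function is `p`-periodic. -/
def IsTestFunction (φ : ℝ × ℝ → ℂ) : Prop :=
  ContDiff ℝ ∞ φ ∧
  (∀ x₁ x₂ : ℝ, φ (x₁ + S.p, x₂) = Complex.exp (-(Complex.I * S.αhat * S.p)) * φ (x₁, x₂)) ∧
  ∃ b' d' : ℝ, S.b < b' ∧ d' < S.d ∧ ∀ x : ℝ × ℝ, x.2 ∉ Set.Icc b' d' → φ x = 0

/-- `g` is the weak derivative in direction `e` of the `α̂`-quasi-periodic function on
`b < x₂ < d` which coincides with `u` on the cell (only the values on the cell enter). -/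
def IsWeakDeriv (e : ℝ × ℝ) (u g : ℝ × ℝ → ℂ) : Prop :=
  ∀ φ : ℝ × ℝ → ℂ, S.IsTestFunction φ →
    ∫ x in S.cell, u x * fderiv ℝ φ x e = -∫ x in S.cell, g x * φ x

abbrev L2 : Type := Lp ℂ 2 (volume.restrict S.cell)

theorem cell_finite : IsFiniteMeasure (volume.restrict S.cell) := by
  refine ⟨?_⟩
  rw [Measure.restrict_apply_univ]
  exact ((Metric.isBounded_Ioo _ _).prod (Metric.isBounded_Ioo _ _)).measure_lt_top

theorem integrable_mul_continuous (u : S.L2) {φ : ℝ × ℝ → ℂ} (hφ : Continuous φ) :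
    Integrable (fun x => u x * φ x) (volume.restrict S.cell) := by
  have := S.cell_finite
  have hu : Integrable u (volume.restrict S.cell) := (Lp.memLp u).integrable (by norm_num)
  have hK : IsCompact (Set.Icc 0 S.p ×ˢ Set.Icc S.b S.d) := isCompact_Icc.prod isCompact_Icc
  obtain ⟨M, hM⟩ := hK.exists_bound_of_continuousOn hφ.continuousOn
  refine hu.mul_bdd (c := M) hφ.aestronglyMeasurable ?_
  refine (ae_restrict_iff' (measurableSet_Ioo.prod measurableSet_Ioo)).2 (ae_of_all _ ?_)
  intro x hx
  exact hM x ⟨Set.Ioo_subset_Icc_self hx.1, Set.Ioo_subset_Icc_self hx.2⟩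

variable {S} in
theorem IsTestFunction.continuous_fderiv_apply {φ : ℝ × ℝ → ℂ} (h : S.IsTestFunction φ)
    (e : ℝ × ℝ) : Continuous fun x => fderiv ℝ φ x e :=
  (h.1.continuous_fderiv (by simp)).clm_apply continuous_const

theorem isWeakDeriv_zero (e : ℝ × ℝ) :
    S.IsWeakDeriv e (0 : S.L2) (0 : S.L2) := by
  intro φ _
  have h : ∀ ψ : ℝ × ℝ → ℂ, ∫ x in S.cell, (0 : S.L2) x * ψ x = 0 := fun ψ => by
    refine integral_eq_zero_of_ae ?_
    filter_upwards [Lp.coeFn_zero ℂ 2 (volume.restrict S.cell)] with x hx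
    rw [hx, Pi.zero_apply, zero_mul]
  rw [h, h, neg_zero]

theorem isWeakDeriv_add (e : ℝ × ℝ) {u v g h : S.L2} (hu : S.IsWeakDeriv e u g)
    (hv : S.IsWeakDeriv e v h) : S.IsWeakDeriv e (u + v : S.L2) (g + h : S.L2) := by
  intro φ hφ
  have key : ∀ (f₁ f₂ : S.L2) (ψ : ℝ × ℝ → ℂ), Continuous ψ →
      ∫ x in S.cell, (f₁ + f₂ : S.L2) x * ψ x
        = (∫ x in S.cell, f₁ x * ψ x) + ∫ x in S.cell, f₂ x * ψ x := fun f₁ f₂ ψ hψ => by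
    rw [← integral_add (S.integrable_mul_continuous f₁ hψ) (S.integrable_mul_continuous f₂ hψ)]
    refine integral_congr_ae ?_
    filter_upwards [Lp.coeFn_add f₁ f₂] with x hx
    rw [hx, Pi.add_apply, add_mul]
  rw [key _ _ _ (hφ.continuous_fderiv_apply e), key _ _ _ hφ.1.continuous, hu φ hφ, hv φ hφ,
    neg_add]

theorem isWeakDeriv_smul (e : ℝ × ℝ) (c : ℂ) {u g : S.L2} (hu : S.IsWeakDeriv e u g) :
    S.IsWeakDeriv e (c • u : S.L2) (c • g : S.L2) := by
  intro φ hφ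
  have key : ∀ (f : S.L2) (ψ : ℝ × ℝ → ℂ),
      ∫ x in S.cell, (c • f : S.L2) x * ψ x = c * ∫ x in S.cell, f x * ψ x := fun f ψ => by
    rw [← integral_const_mul]
    refine integral_congr_ae ?_
    filter_upwards [Lp.coeFn_smul c f] with x hx
    rw [hx, Pi.smul_apply, smul_eq_mul, mul_assoc]
  rw [key, key, hu φ hφ, mul_neg]

/-- The space `H¹_α̂(C)`, a function being listed with its weak gradient as
`(u, ∂₁u, ∂₂u) ∈ L²(C)³`, with the norm `(‖u‖² + ‖∂₁u‖² + ‖∂₂u‖²)^(1/2)`. -/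
def H1 : Submodule ℂ (PiLp 2 fun _ : Fin 3 => S.L2) where
  carrier := {U | S.IsWeakDeriv (1, 0) (U 0) (U 1) ∧ S.IsWeakDeriv (0, 1) (U 0) (U 2)}
  zero_mem' := ⟨S.isWeakDeriv_zero _, S.isWeakDeriv_zero _⟩
  add_mem' := fun hU hV =>
    ⟨S.isWeakDeriv_add _ hU.1 hV.1, S.isWeakDeriv_add _ hU.2 hV.2⟩
  smul_mem' := fun c _ hU => ⟨S.isWeakDeriv_smul _ c hU.1, S.isWeakDeriv_smul _ c hU.2⟩

variable {S}

/-- The function itself. -/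
def val (u : S.H1) : ℝ × ℝ → ℂ := (u.1 0 : S.L2)

/-- Its weak derivative `∂₁u`. -/
def d₁ (u : S.H1) : ℝ × ℝ → ℂ := (u.1 1 : S.L2)

/-- Its weak derivative `∂₂u`. -/
def d₂ (u : S.H1) : ℝ × ℝ → ℂ := (u.1 2 : S.L2)

/-- Fourier coefficients of the trace of `u` on `x₂ = d`. -/
def topCoeff (u : S.H1) : ℤ → ℂ :=
  S.fourierCoefficient (traceAbove S.b S.d (val u) (d₂ u))

/-- Fourier coefficients of the trace of `u` on `x₂ = b`. -/
def bottomCoeff (u : S.H1) : ℤ → ℂ :=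
  S.fourierCoefficient (traceBelow S.b S.d (val u) (d₂ u))

variable (S)

/-- The sesquilinear form `a(u, v)` of the diffraction problem. -/
def form (u v : S.H1) : ℂ :=
  (∫ x in S.cell, (d₁ u x * conj (d₁ v x) + d₂ u x * conj (d₂ v x)
      - (S.k : ℂ) ^ 2 * S.refractiveIndex x * val u x * conj (val v x)))
    - S.pairing (S.T (topCoeff u)) (topCoeff v)
    - S.pairing (S.Tminus (bottomCoeff u)) (bottomCoeff v)

/-- `∫ (∇u · ∇v̄ + u v̄)`, minus the boundary terms of `T` and of the modes `|n| > N` of `T⁻`. -/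
def principalForm (N : ℕ) (u v : S.H1) : ℂ :=
  (∫ x in S.cell, (d₁ u x * conj (d₁ v x) + d₂ u x * conj (d₂ v x)
      + val u x * conj (val v x)))
    - S.pairing (S.T (topCoeff u)) (topCoeff v)
    - S.pairing (S.TminusHigh N (bottomCoeff u)) (bottomCoeff v)

/-- `∫ (k² q̃ + 1) u v̄` plus the boundary term of the modes `|n| ≤ N` of `T⁻`. -/
def lowerOrderForm (N : ℕ) (u v : S.H1) : ℂ :=
  (∫ x in S.cell, ((S.k : ℂ) ^ 2 * S.refractiveIndex x + 1) * val u x * conj (val v x))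
    + S.pairing (S.TminusLow N (bottomCoeff u)) (bottomCoeff v)

end GratingProblem

end

/-!
Let `|n|` be so large that the potential `V = k² q - αₙ²` of Hill's equation `u'' = -V u` is
negative. Green's formula then makes `u' u` increasing along every real solution, and for a mode
that grows by a factor `l > 1` over a period this forces `u' u > 0`. As `V ≥ -αₙ²`, the energy
`u'² - αₙ² u²` decreases where `u' u > 0`; over a period it is multiplied by `l²`, so it is
nonpositive and `|u'| ≤ |αₙ| |u|`. The downward mode is real up to a constant factor, hence `τₙ` is
real with `-|αₙ| ≤ τₙ < 0`. Together with `|βₙ| = O(1 + |αₙ|)` and the trace inequality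
`∑ (1 + |αₙ|) |uₙ|² ≤ K ‖u‖²`, obtained from the one-dimensional slices `x₂ ↦ ∫ u e^{-iαₙx₁} dx₁`,
both Dirichlet-to-Neumann maps define bounded forms.

The form `B` is the inner product of `H¹` minus forms whose symbols `iβₙ` and `τₙ`, `|n| > N`, have
nonpositive real part, so it is coercive with constant `1`. The form `Q` is an `L²` form with a
bounded weight, compact because the embedding of `H¹` in `L²` is, plus a form of finite rank.
-/

noncomputable section

/-! ### Carathéodory solutions of Hill's equation -/

section Existence

variable {E : Type} [NormedAddCommGroup E] [NormedSpace ℝ E] {V : ℝ → ℝ}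

theorem intervalIntegrable_smul (hV : LocallyIntegrable V) {y : ℝ → E} (hy : Continuous y)
    (a b : ℝ) : IntervalIntegrable (fun t => V t • y t) volume a b :=
  (hV.integrableOn_isCompact isCompact_uIcc).intervalIntegrable.smul_continuousOn hy.continuousOn

theorem exists_ae_norm_le_of_memLp_top {X F : Type*} [MeasurableSpace X] [NormedAddCommGroup F]
    {μ : Measure X} {f : X → F} (hf : MemLp f ⊤ μ) : ∃ M : ℝ, 0 < M ∧ ∀ᵐ x ∂μ, ‖f x‖ ≤ M := by
  refine ⟨max 1 (eLpNorm f ⊤ μ).toReal, by positivity, ?_⟩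
  filter_upwards [ae_le_eLpNormEssSup (f := f) (μ := μ)] with x hx
  refine le_max_of_le_right ?_
  rw [← toReal_enorm, eLpNorm_exponent_top]
  exact ENNReal.toReal_mono (eLpNorm_exponent_top (f := f) ▸ hf.2.ne) hx

theorem integral_cosh_mul {L : ℝ} (hL : L ≠ 0) (x : ℝ) :
    ∫ t in (0 : ℝ)..x, Real.cosh (L * t) = Real.sinh (L * x) / L := by
  have hderiv : ∀ t : ℝ, HasDerivAt (fun s => Real.sinh (L * s) / L) (Real.cosh (L * t)) t := by
    intro t
    refine (((hasDerivAt_id t).const_mul L).sinh.div_const L).congr_deriv ?_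
    simp [hL]
  rw [intervalIntegral.integral_eq_sub_of_hasDerivAt (fun t _ => hderiv t)
    (Continuous.intervalIntegrable (by fun_prop) _ _)]
  simp

theorem norm_integral_le_cosh {L C : ℝ} (hL : 0 < L) (hC : 0 ≤ C) {f : ℝ → E}
    (hf : ∀ᵐ t : ℝ, ‖f t‖ ≤ C * Real.cosh (L * t)) (x : ℝ) :
    ‖∫ t in (0 : ℝ)..x, f t‖ ≤ C / L * Real.cosh (L * x) := by
  have hsinh : |Real.sinh (L * x)| ≤ Real.cosh (L * x) := by
    rw [Real.abs_sinh, ← Real.cosh_abs]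
    exact (Real.sinh_lt_cosh _).le
  calc ‖∫ t in (0 : ℝ)..x, f t‖
      ≤ |∫ t in (0 : ℝ)..x, C * Real.cosh (L * t)| :=
        intervalIntegral.norm_integral_le_abs_of_norm_le (ae_restrict_of_ae hf)
          (Continuous.intervalIntegrable (by fun_prop) _ _)
    _ = C / L * |Real.sinh (L * x)| := by
        rw [intervalIntegral.integral_const_mul, integral_cosh_mul hL.ne', abs_mul, abs_div,
          abs_of_nonneg hC, abs_of_pos hL]
        ring
    _ ≤ C / L * Real.cosh (L * x) := by gcongr

/-- The Volterra operator `y ↦ ∫₀ˣ ∫₀ˢ V y`, through which Hill's equation reads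
`y(x) = y(0) + y'(0) x - hillVolterra V y x`. -/
def hillVolterra (V : ℝ → ℝ) (y : ℝ → E) (x : ℝ) : E :=
  ∫ s in (0 : ℝ)..x, ∫ t in (0 : ℝ)..s, V t • y t

theorem hasDerivAt_hillVolterra [CompleteSpace E] (hV : LocallyIntegrable V) {y : ℝ → E}
    (hy : Continuous y) (x : ℝ) :
    HasDerivAt (hillVolterra V y) (∫ t in (0 : ℝ)..x, V t • y t) x :=
  ((intervalIntegral.continuous_primitive (intervalIntegrable_smul hV hy)
    0).integral_hasStrictDerivAt 0 x).hasDerivAt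

theorem continuous_hillVolterra (hV : LocallyIntegrable V) {y : ℝ → E}
    (hy : Continuous y) : Continuous (hillVolterra V y) :=
  intervalIntegral.continuous_primitive (fun _ _ => (intervalIntegral.continuous_primitive
    (intervalIntegrable_smul hV hy) 0).intervalIntegrable _ _) 0

theorem hillVolterra_sub (hV : LocallyIntegrable V) {y z : ℝ → E} (hy : Continuous y)
    (hz : Continuous z) (x : ℝ) :
    hillVolterra V (fun t => y t - z t) x = hillVolterra V y x - hillVolterra V z x := by
  have hint := fun {w : ℝ → E} (hw : Continuous w) => intervalIntegrable_smul hV hw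
  simp only [hillVolterra, smul_sub]
  rw [← intervalIntegral.integral_sub
    ((intervalIntegral.continuous_primitive (hint hy) 0).intervalIntegrable _ _)
    ((intervalIntegral.continuous_primitive (hint hz) 0).intervalIntegrable _ _)]
  exact intervalIntegral.integral_congr fun s _ =>
    intervalIntegral.integral_sub (hint hy 0 s) (hint hz 0 s)

theorem norm_hillVolterra_le {L M C : ℝ} (hL : 0 < L) (hM : ∀ᵐ t : ℝ, ‖V t‖ ≤ M) (hC : 0 ≤ C)
    {y : ℝ → E} (hy : ∀ t, ‖y t‖ ≤ C * Real.cosh (L * t)) (x : ℝ) :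
    ‖hillVolterra V y x‖ ≤ M / L ^ 2 * C * Real.cosh (L * x) := by
  have hM0 : 0 ≤ M := by
    obtain ⟨t, ht⟩ := hM.exists
    exact (norm_nonneg _).trans ht
  have hVy : ∀ᵐ t : ℝ, ‖V t • y t‖ ≤ M * C * Real.cosh (L * t) := by
    filter_upwards [hM] with t ht
    rw [norm_smul, mul_assoc]
    exact mul_le_mul ht (hy t) (norm_nonneg _) hM0
  have hinner := norm_integral_le_cosh hL (mul_nonneg hM0 hC) hVy
  refine (norm_integral_le_cosh hL (by positivity) (ae_of_all _ hinner) x).trans_eq ?_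
  field_simp

/-- The contraction principle in the weighted norm `sup ‖y(x)‖ / W(x)`. -/
theorem exists_continuous_fixedPoint_of_weight {X F : Type*} [TopologicalSpace X]
    [NormedAddCommGroup F] [NormedSpace ℝ F] [CompleteSpace F] {W : X → ℝ} (hW : Continuous W)
    (hpos : ∀ x, 0 < W x) {K : NNReal} (hK : K < 1) {Φ : (X → F) → X → F}
    (hcont : ∀ y, Continuous y → Continuous (Φ y)) {C₀ : ℝ} (hzero : ∀ x, ‖Φ 0 x‖ ≤ C₀ * W x)
    (hlip : ∀ y z, Continuous y → Continuous z → ∀ C : ℝ, 0 ≤ C →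
      (∀ x, ‖y x - z x‖ ≤ C * W x) → ∀ x, ‖Φ y x - Φ z x‖ ≤ K * C * W x) :
    ∃ y, Continuous y ∧ Φ y = y := by
  let weighted (g : BoundedContinuousFunction X F) (x : X) : F := W x • g x
  have hweighted : ∀ g, Continuous (weighted g) := fun g => by fun_prop
  have hdist : ∀ g h x, ‖Φ (weighted g) x - Φ (weighted h) x‖ ≤ K * dist g h * W x :=
    fun g h => hlip _ _ (hweighted g) (hweighted h) _ dist_nonneg fun x => by
      rw [← smul_sub, norm_smul, Real.norm_of_nonneg (hpos x).le, mul_comm, ← dist_eq_norm]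
      exact mul_le_mul_of_nonneg_right (BoundedContinuousFunction.dist_coe_le_dist x) (hpos x).le
  let Ψ (g : BoundedContinuousFunction X F) : BoundedContinuousFunction X F :=
    BoundedContinuousFunction.ofNormedAddCommGroup (fun x => (W x)⁻¹ • Φ (weighted g) x)
      (Continuous.smul (hW.inv₀ fun x => (hpos x).ne') (hcont _ (hweighted g)))
      (K * dist g 0 + C₀) (fun x => by
        rw [norm_smul, norm_inv, Real.norm_of_nonneg (hpos x).le, inv_mul_le_iff₀ (hpos x)]
        have hw0 : weighted 0 = 0 := funext fun x => smul_zero _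
        calc ‖Φ (weighted g) x‖ ≤ ‖Φ (weighted g) x - Φ (weighted 0) x‖ + ‖Φ 0 x‖ := by
              rw [hw0]; exact norm_le_norm_sub_add _ _
          _ ≤ K * dist g 0 * W x + C₀ * W x := add_le_add (hdist g 0 x) (hzero x)
          _ = W x * (K * dist g 0 + C₀) := by ring)
  have hΨ : ContractingWith K Ψ := by
    refine ⟨hK, LipschitzWith.of_dist_le_mul fun g h => ?_⟩
    refine (BoundedContinuousFunction.dist_le (by positivity)).2 fun x => ?_
    rw [dist_eq_norm, BoundedContinuousFunction.coe_ofNormedAddCommGroup,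
      BoundedContinuousFunction.coe_ofNormedAddCommGroup, ← smul_sub, norm_smul, norm_inv,
      Real.norm_of_nonneg (hpos x).le, inv_mul_le_iff₀ (hpos x), mul_comm (W x)]
    exact hdist g h x
  refine ⟨weighted (hΨ.fixedPoint Ψ), hweighted _, funext fun x => ?_⟩
  have hfix : _ = hΨ.fixedPoint Ψ x := DFunLike.congr_fun hΨ.fixedPoint_isFixedPt x
  rw [← smul_inv_smul₀ (hpos x).ne' (Φ _ x)]
  exact congrArg (W x • ·) hfix

theorem abs_le_cosh_mul {L : ℝ} (hL : 1 ≤ L) (x : ℝ) : |x| ≤ Real.cosh (L * x) := by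
  calc |x| ≤ |L * x| := by
        rw [abs_mul, abs_of_pos (one_pos.trans_le hL)]
        exact le_mul_of_one_le_left (abs_nonneg _) hL
    _ ≤ Real.sinh |L * x| := Real.self_le_sinh_iff.2 (abs_nonneg _)
    _ ≤ Real.cosh |L * x| := (Real.sinh_lt_cosh _).le
    _ = Real.cosh (L * x) := Real.cosh_abs _

theorem exists_eq_sub_hillVolterra [CompleteSpace E] (hV : MemLp V ⊤ volume) (a₀ a₁ : E) :
    ∃ y : ℝ → E, Continuous y ∧ ∀ x, y x = a₀ + x • a₁ - hillVolterra V y x := by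
  have hVloc : LocallyIntegrable V := hV.locallyIntegrable le_top
  obtain ⟨M, hM0, hM⟩ := exists_ae_norm_le_of_memLp_top hV
  let L : ℝ := 1 + 2 * M
  have hL : 0 < L := by positivity
  have hsmall : M / L ^ 2 ≤ ((1 / 2 : NNReal) : ℝ) := by
    rw [NNReal.coe_div, div_le_div_iff₀ (by positivity) (by simp)]
    simp only [L, NNReal.coe_one, NNReal.coe_ofNat]
    nlinarith
  obtain ⟨y, hyc, hy⟩ := exists_continuous_fixedPoint_of_weight (K := 1 / 2)
    (C₀ := ‖a₀‖ + ‖a₁‖) (Φ := fun y x => a₀ + x • a₁ - hillVolterra V y x)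
    (by fun_prop : Continuous fun x => Real.cosh (L * x)) (fun x => Real.cosh_pos _)
    (by norm_num)
    (fun y hy => (by fun_prop : Continuous fun x : ℝ => a₀ + x • a₁).sub
      (continuous_hillVolterra hVloc hy))
    (fun x => by
      have hx := abs_le_cosh_mul (show 1 ≤ L by simp only [L]; linarith) x
      calc ‖a₀ + x • a₁ - hillVolterra V 0 x‖ ≤ ‖a₀‖ + |x| * ‖a₁‖ := by
            simpa [hillVolterra, norm_smul] using norm_add_le a₀ (x • a₁)
        _ ≤ ‖a₀‖ * Real.cosh (L * x) + Real.cosh (L * x) * ‖a₁‖ := by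
            gcongr
            exact le_mul_of_one_le_right (norm_nonneg _) (Real.one_le_cosh _)
        _ = (‖a₀‖ + ‖a₁‖) * Real.cosh (L * x) := by ring)
    (fun y z hy hz C hC hyz x => by
      rw [sub_sub_sub_cancel_left, norm_sub_rev, ← hillVolterra_sub hVloc hy hz]
      refine (norm_hillVolterra_le hL hM hC hyz x).trans ?_
      gcongr)
  exact ⟨y, hyc, fun x => (congrFun hy x).symm⟩

theorem exists_isHillSolution [CompleteSpace E] (hV : MemLp V ⊤ volume) (a₀ a₁ : E) :
    ∃ y : ℝ → E, IsHillSolution V y ∧ y 0 = a₀ ∧ deriv y 0 = a₁ := by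
  obtain ⟨y, hyc, hy⟩ := exists_eq_sub_hillVolterra hV a₀ a₁
  have hderiv : ∀ x, HasDerivAt y (a₁ - ∫ t in (0 : ℝ)..x, V t • y t) x := fun x => by
    have hlin : HasDerivAt (fun x : ℝ => a₀ + x • a₁) a₁ x := by
      simpa using ((hasDerivAt_id x).smul_const a₁).const_add a₀
    exact (hlin.sub (hasDerivAt_hillVolterra (hV.locallyIntegrable le_top) hyc
      x)).congr_of_eventuallyEq (.of_forall hy)
  have hderiv0 : deriv y 0 = a₁ := by simpa using (hderiv 0).deriv
  refine ⟨y, ⟨fun x => (hderiv x).differentiableAt, fun x => ?_⟩, ?_, hderiv0⟩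
  · rw [hderiv0, (hderiv x).deriv]
  · simp [hy 0, hillVolterra]

end Existence

theorem eq_zero_of_le_mul_integral {f : ℝ → ℝ} {C R : ℝ} (hf : Continuous f)
    (hpos : ∀ x ∈ Set.Icc 0 R, 0 ≤ f x)
    (hle : ∀ x ∈ Set.Icc 0 R, f x ≤ C * ∫ t in (0 : ℝ)..x, f t) {x : ℝ} (hx : x ∈ Set.Icc 0 R) :
    f x = 0 := by
  have hderiv : ∀ t, HasDerivAt (fun s => ∫ τ in (0 : ℝ)..s, f τ) (f t) t := fun t =>
    (hf.integral_hasStrictDerivAt 0 t).hasDerivAt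
  have hzero := eq_zero_of_abs_deriv_le_mul_abs_self_of_eq_zero_right (K := C)
    (fun t _ => (hderiv t).continuousAt.continuousWithinAt)
    (fun t _ => (hderiv t).hasDerivWithinAt) intervalIntegral.integral_same
    (fun t ht => by
      have hint : 0 ≤ ∫ τ in (0 : ℝ)..t, f τ := intervalIntegral.integral_nonneg ht.1 fun τ hτ =>
        hpos τ ⟨hτ.1, hτ.2.trans ht.2.le⟩
      rw [Real.norm_of_nonneg (hpos t (Set.Ico_subset_Icc_self ht)), Real.norm_of_nonneg hint]
      exact hle t (Set.Ico_subset_Icc_self ht)) x hx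
  have := hle x hx
  rw [hzero, mul_zero] at this
  exact this.antisymm (hpos x hx)

namespace IsHillSolution

section Identities

variable {E F : Type} [NormedAddCommGroup E] [NormedSpace ℝ E] [NormedAddCommGroup F]
  [NormedSpace ℝ F] {V : ℝ → ℝ} {u v : ℝ → E}

theorem continuous (hu : IsHillSolution V u) : Continuous u := hu.1.continuous

theorem hasDerivAt (hu : IsHillSolution V u) (x : ℝ) : HasDerivAt u (deriv u x) x :=
  (hu.1 x).hasDerivAt

theorem continuous_deriv (hV : LocallyIntegrable V) (hu : IsHillSolution V u) :
    Continuous (deriv u) := by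
  rw [funext hu.2]
  exact continuous_const.sub
    (intervalIntegral.continuous_primitive (intervalIntegrable_smul hV hu.continuous) 0)

theorem clm_comp [CompleteSpace E] [CompleteSpace F] (hV : LocallyIntegrable V)
    (hu : IsHillSolution V u) (A : E →L[ℝ] F) : IsHillSolution V fun t => A (u t) := by
  have hderiv : ∀ x, HasDerivAt (fun t => A (u t)) (A (deriv u x)) x := fun x =>
    A.hasFDerivAt.comp_hasDerivAt x (hu.hasDerivAt x)
  refine ⟨fun x => (hderiv x).differentiableAt, fun x => ?_⟩
  rw [(hderiv x).deriv, (hderiv 0).deriv, hu.2 x, map_sub,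
    ← A.intervalIntegral_comp_comm (intervalIntegrable_smul hV hu.continuous _ _)]
  simp only [map_smul]

theorem const_smul (hu : IsHillSolution V u) (c : ℝ) : IsHillSolution V fun t => c • u t := by
  refine ⟨hu.1.const_smul c, fun x => ?_⟩
  simp only [deriv_fun_const_smul_field, smul_comm _ c, intervalIntegral.integral_smul,
    hu.2 x, smul_sub]

theorem add (hV : LocallyIntegrable V) (hu : IsHillSolution V u) (hv : IsHillSolution V v) :
    IsHillSolution V fun t => u t + v t := by
  refine ⟨hu.1.add hv.1, fun x => ?_⟩
  rw [deriv_fun_add (hu.1 x) (hv.1 x), deriv_fun_add (hu.1 0) (hv.1 0), hu.2 x, hv.2 x]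
  simp only [smul_add]
  rw [intervalIntegral.integral_add (intervalIntegrable_smul hV hu.continuous _ _)
    (intervalIntegrable_smul hV hv.continuous _ _)]
  abel

theorem deriv_eq_sub (hV : LocallyIntegrable V) (hu : IsHillSolution V u) (a x : ℝ) :
    deriv u x = deriv u a - ∫ t in a..x, V t • u t := by
  have hint := intervalIntegrable_smul hV hu.continuous
  rw [hu.2 x, hu.2 a, ← intervalIntegral.integral_add_adjacent_intervals (hint 0 a) (hint a x)]
  abel

theorem comp_add_period (hV : LocallyIntegrable V) {T : ℝ} (hT : Function.Periodic V T)
    (hu : IsHillSolution V u) : IsHillSolution V fun t => u (t + T) := by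
  refine ⟨fun x => (hu.1 (x + T)).comp x (differentiableAt_id.add_const T), fun x => ?_⟩
  have hshift : ∫ t in (0 : ℝ)..x, V t • u (t + T) = ∫ t in T..(x + T), V t • u t := by
    simpa only [hT _, zero_add] using
      intervalIntegral.integral_comp_add_right (a := 0) (b := x) (fun t => V t • u t) T
  rw [deriv_comp_add_const, deriv_comp_add_const, zero_add, hshift]
  exact hu.deriv_eq_sub hV T (x + T)

theorem comp_neg (hu : IsHillSolution V u) :
    IsHillSolution (fun t => V (-t)) fun t => u (-t) := by
  refine ⟨fun x => (hu.1 (-x)).comp x differentiableAt_id.neg, fun x => ?_⟩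
  rw [deriv_comp_neg, deriv_comp_neg, hu.2 (-x), neg_zero,
    intervalIntegral.integral_comp_neg (fun t => V t • u t), neg_zero,
    intervalIntegral.integral_symm (-x) 0]
  abel

theorem norm_deriv_le {M : ℝ} (hM : ∀ᵐ t : ℝ, ‖V t‖ ≤ M) (hu : IsHillSolution V u)
    (h1 : deriv u 0 = 0) {x : ℝ} (hx : 0 ≤ x) :
    ‖deriv u x‖ ≤ M * ∫ t in (0 : ℝ)..x, ‖u t‖ := by
  rw [hu.2 x, h1, zero_sub, norm_neg, ← intervalIntegral.integral_const_mul]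
  refine intervalIntegral.norm_integral_le_of_norm_le hx ?_
    ((hu.continuous.norm.const_mul M).intervalIntegrable _ _)
  filter_upwards [hM] with t ht _
  rw [norm_smul]
  exact mul_le_mul_of_nonneg_right ht (norm_nonneg _)

theorem eq_zero_of_nonneg (hV : MemLp V ⊤ volume) (hu : IsHillSolution V u) (h0 : u 0 = 0)
    (h1 : deriv u 0 = 0) {R : ℝ} (hR : 0 ≤ R) : u R = 0 := by
  obtain ⟨M, hM0, hM⟩ := exists_ae_norm_le_of_memLp_top hV
  have hgronwall : ∀ x ∈ Set.Icc 0 R, ‖u x‖ ≤ M * R * ∫ t in (0 : ℝ)..x, ‖u t‖ := by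
    intro x hx
    have hint : ∀ {t s : ℝ}, t ≤ s → 0 ≤ ∫ τ in t..s, ‖u τ‖ := fun hts =>
      intervalIntegral.integral_nonneg hts fun _ _ => norm_nonneg _
    have hderiv : ∀ t ∈ Set.Ico 0 x, ‖deriv u t‖ ≤ M * ∫ τ in (0 : ℝ)..x, ‖u τ‖ := by
      intro t ht
      refine (hu.norm_deriv_le hM h1 ht.1).trans (mul_le_mul_of_nonneg_left ?_ hM0.le)
      rw [← intervalIntegral.integral_add_adjacent_intervals
        (hu.continuous.norm.intervalIntegrable 0 t) (hu.continuous.norm.intervalIntegrable t x)]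
      exact le_add_of_nonneg_right (hint ht.2.le)
    have hmean := norm_image_sub_le_of_norm_deriv_le_segment'
      (fun t _ => (hu.hasDerivAt t).hasDerivWithinAt) hderiv x ⟨hx.1, le_rfl⟩
    rw [h0, sub_zero, sub_zero] at hmean
    calc ‖u x‖ ≤ M * (∫ t in (0 : ℝ)..x, ‖u t‖) * x := hmean
      _ ≤ M * (∫ t in (0 : ℝ)..x, ‖u t‖) * R :=
          mul_le_mul_of_nonneg_left hx.2 (mul_nonneg hM0.le (hint hx.1))
      _ = M * R * ∫ t in (0 : ℝ)..x, ‖u t‖ := by ring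
  exact norm_eq_zero.1 (eq_zero_of_le_mul_integral hu.continuous.norm
    (fun _ _ => norm_nonneg _) hgronwall ⟨hR, le_rfl⟩)

theorem eq_zero (hV : MemLp V ⊤ volume) (hu : IsHillSolution V u) (h0 : u 0 = 0)
    (h1 : deriv u 0 = 0) (x : ℝ) : u x = 0 := by
  rcases le_total 0 x with hx | hx
  · exact hu.eq_zero_of_nonneg hV h0 h1 hx
  · have hneg := hu.comp_neg.eq_zero_of_nonneg
      (hV.comp_measurePreserving (Measure.measurePreserving_neg volume)) (by simpa using h0)
      (by simp [deriv_comp_neg, h1]) (neg_nonneg.2 hx)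
    simpa using hneg

theorem ext_of_initial (hV : MemLp V ⊤ volume) (hu : IsHillSolution V u)
    (hv : IsHillSolution V v) (h0 : u 0 = v 0) (h1 : deriv u 0 = deriv v 0) : u = v := by
  have hsub := hu.add (hV.locallyIntegrable le_top) (hv.const_smul (-1))
  have hderiv : deriv (fun t => u t + (-1 : ℝ) • v t) 0 = 0 :=
    (((hu.hasDerivAt 0).add ((hv.hasDerivAt 0).const_smul (-1 : ℝ))).congr_deriv
      (by rw [h1]; module)).deriv
  funext x
  have := hsub.eq_zero hV (by rw [h0]; module) hderiv x
  rwa [neg_one_smul, ← sub_eq_add_neg, sub_eq_zero] at this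

end Identities

section NonpositivePotential

variable {V y : ℝ → ℝ}

theorem absolutelyContinuousOnInterval (hV : LocallyIntegrable V) (hy : IsHillSolution V y)
    (a b : ℝ) : AbsolutelyContinuousOnInterval y a b :=
  (contDiff_one_iff_deriv.2
    ⟨hy.1, hy.continuous_deriv hV⟩).contDiffOn.absolutelyContinuousOnInterval

theorem absolutelyContinuousOnInterval_deriv (hV : LocallyIntegrable V)
    (hy : IsHillSolution V y) (a b : ℝ) : AbsolutelyContinuousOnInterval (deriv y) a b := by
  rw [funext fun x => (hy.deriv_eq_sub hV a x).trans (sub_eq_add_neg _ _)]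
  have hconst : AbsolutelyContinuousOnInterval (fun _ : ℝ => deriv y a) a b :=
    contDiff_const.contDiffOn.absolutelyContinuousOnInterval
  exact hconst.add ((intervalIntegrable_smul hV hy.continuous a
    b).absolutelyContinuousOnInterval_intervalIntegral Set.left_mem_uIcc).neg

theorem ae_deriv_deriv (hV : LocallyIntegrable V) (hy : IsHillSolution V y) :
    ∀ᵐ x : ℝ, deriv (deriv y) x = -(V x * y x) := by
  filter_upwards [LocallyIntegrable.ae_hasDerivAt_integral (hV.smul_continuous hy.continuous)]
    with x hx
  rw [funext hy.2]
  exact ((hx 0).const_sub _).deriv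

theorem integral_green (hV : LocallyIntegrable V) (hy : IsHillSolution V y) {g : ℝ → ℝ}
    {a b : ℝ} (hg : AbsolutelyContinuousOnInterval g a b) :
    ∫ x in a..b, (deriv y x * deriv g x - V x * (y x * g x))
      = deriv y b * g b - deriv y a * g a := by
  rw [← (hy.absolutelyContinuousOnInterval_deriv hV a b).integral_deriv_mul_eq_sub hg]
  refine intervalIntegral.integral_congr_ae ?_
  filter_upwards [hy.ae_deriv_deriv hV] with x hx _
  rw [hx]
  ring

theorem monotone_deriv_mul_self (hV : LocallyIntegrable V) (hneg : ∀ᵐ t : ℝ, V t ≤ 0)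
    (hy : IsHillSolution V y) : Monotone fun x => deriv y x * y x := by
  intro a b hab
  rw [← sub_nonneg, ← hy.integral_green hV (hy.absolutelyContinuousOnInterval hV a b)]
  refine intervalIntegral.integral_nonneg_of_ae_restrict hab ?_
  filter_upwards [ae_restrict_of_ae hneg] with t ht
  simp only [Pi.zero_apply]
  nlinarith [mul_self_nonneg (deriv y t), mul_nonneg (neg_nonneg.2 ht) (mul_self_nonneg (y t))]

theorem sq_deriv_sub_sq_le (hV : LocallyIntegrable V) {K : ℝ} (hK : ∀ᵐ t : ℝ, -K ^ 2 ≤ V t)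
    (hy : IsHillSolution V y) {a b : ℝ} (hab : a ≤ b)
    (hpos : ∀ t ∈ Set.Icc a b, 0 ≤ deriv y t * y t) :
    deriv y b ^ 2 - deriv y a ^ 2 ≤ K ^ 2 * y b ^ 2 - K ^ 2 * y a ^ 2 := by
  have hc := hy.continuous_deriv hV
  have henergy : ∫ x in a..b, -(2 * (V x * (y x * deriv y x))) = deriv y b ^ 2 - deriv y a ^ 2 := by
    rw [sq, sq, ← hy.integral_green hV (hy.absolutelyContinuousOnInterval_deriv hV a b)]
    refine intervalIntegral.integral_congr_ae ?_
    filter_upwards [hy.ae_deriv_deriv hV] with x hx _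
    rw [hx]
    ring
  have hsq : ∫ x in a..b, 2 * K ^ 2 * (deriv y x * y x) = K ^ 2 * y b ^ 2 - K ^ 2 * y a ^ 2 := by
    refine intervalIntegral.integral_eq_sub_of_hasDerivAt (f := fun x => K ^ 2 * y x ^ 2)
      (fun x _ => (((hy.hasDerivAt x).pow 2).const_mul (K ^ 2)).congr_deriv ?_)
      (((hc.mul hy.continuous).const_mul _).intervalIntegrable _ _)
    ring
  rw [← henergy, ← hsq]
  refine intervalIntegral.integral_mono_ae_restrict hab
    ((intervalIntegrable_smul hV (hy.continuous.mul hc) a b).const_mul 2).neg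
    (((hc.mul hy.continuous).const_mul _).intervalIntegrable _ _) ?_
  filter_upwards [ae_restrict_of_ae hK, ae_restrict_mem measurableSet_Icc] with t ht hmem
  nlinarith [mul_nonneg (sub_nonneg.2 ht) (hpos t hmem)]

theorem le_deriv (hneg : ∀ᵐ t : ℝ, V t ≤ 0)
    (hy : IsHillSolution V y) {x : ℝ} (hx : 0 ≤ x) (hpos : ∀ t ∈ Set.Icc 0 x, 0 ≤ y t) :
    deriv y 0 ≤ deriv y x := by
  rw [hy.2 x, sub_eq_add_neg, ← intervalIntegral.integral_neg, le_add_iff_nonneg_right]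
  refine intervalIntegral.integral_nonneg_of_ae_restrict hx ?_
  filter_upwards [ae_restrict_of_ae hneg, ae_restrict_mem measurableSet_Icc] with t ht hmem
  exact neg_nonneg.2 (mul_nonpos_of_nonpos_of_nonneg ht (hpos t hmem))

theorem lt_deriv (hV : LocallyIntegrable V) (hneg : ∀ᵐ t : ℝ, V t < 0)
    (hy : IsHillSolution V y) {x : ℝ} (hx : 0 < x) (hpos : ∀ t ∈ Set.Ioc 0 x, 0 < y t) :
    deriv y 0 < deriv y x := by
  rw [hy.2 x, sub_eq_add_neg, ← intervalIntegral.integral_neg, lt_add_iff_pos_right]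
  have hae : ∀ᵐ t ∂volume.restrict (Set.Ioc 0 x), 0 < -(V t • y t) := by
    filter_upwards [ae_restrict_of_ae hneg, ae_restrict_mem measurableSet_Ioc] with t ht hmem
    exact neg_pos.2 (mul_neg_of_neg_of_pos ht (hpos t hmem))
  refine (intervalIntegral.integral_pos_iff_support_of_nonneg_ae'
    (by rw [Set.uIoc_of_le hx.le]; exact hae.mono fun t ht => ht.le)
    (intervalIntegrable_smul hV hy.continuous 0 x).neg).2 ⟨hx, ?_⟩
  have hsupp : (Function.support (-fun t => V t • y t) : Set ℝ)
      =ᵐ[volume.restrict (Set.Ioc 0 x)] Set.univ :=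
    eventuallyEq_univ.2 (hae.mono fun t ht => ht.ne')
  rw [← Measure.restrict_apply' measurableSet_Ioc, measure_congr hsupp,
    Measure.restrict_apply_univ, Real.volume_Ioc]
  simpa using hx

theorem neg_integral_negPart_le_deriv {M : ℝ} (hM : ∀ᵐ t : ℝ, ‖V t‖ ≤ M)
    (hV : LocallyIntegrable V) (hneg : ∀ᵐ t : ℝ, V t ≤ 0) (hy : IsHillSolution V y)
    (h1 : 0 ≤ deriv y 0) {x : ℝ} (hx : 0 ≤ x) :
    -(M * ∫ t in (0 : ℝ)..x, (y t)⁻) ≤ deriv y x := by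
  rw [hy.2 x, ← intervalIntegral.integral_const_mul]
  suffices ∫ t in (0 : ℝ)..x, V t • y t ≤ ∫ t in (0 : ℝ)..x, M * (y t)⁻ by linarith
  refine intervalIntegral.integral_mono_ae_restrict hx
    (intervalIntegrable_smul hV hy.continuous _ _)
    (((continuous_negPart.comp hy.continuous).const_mul M).intervalIntegrable _ _) ?_
  filter_upwards [ae_restrict_of_ae hM, ae_restrict_of_ae hneg] with t ht ht'
  calc V t * y t = V t * (y t)⁺ + -V t * (y t)⁻ := by
        rw [neg_mul, ← sub_eq_add_neg, ← mul_sub, posPart_sub_negPart]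
    _ ≤ 0 + M * (y t)⁻ :=
        add_le_add (mul_nonpos_of_nonpos_of_nonneg ht' (posPart_nonneg _))
          (mul_le_mul_of_nonneg_right ((neg_le_abs _).trans ht) (negPart_nonneg _))
    _ = M * (y t)⁻ := zero_add _

theorem nonneg (hV : MemLp V ⊤ volume) (hneg : ∀ᵐ t : ℝ, V t ≤ 0) (hy : IsHillSolution V y)
    (h0 : 0 ≤ y 0) (h1 : 0 ≤ deriv y 0) {R : ℝ} (hR : 0 ≤ R) : 0 ≤ y R := by
  obtain ⟨M, hM0, hM⟩ := exists_ae_norm_le_of_memLp_top hV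
  have hcont : Continuous fun t => (y t)⁻ := continuous_negPart.comp hy.continuous
  have hgronwall : ∀ x ∈ Set.Icc 0 R, (y x)⁻ ≤ M * R * ∫ t in (0 : ℝ)..x, (y t)⁻ := by
    intro x hx
    have hint : ∀ {t s : ℝ}, t ≤ s → 0 ≤ ∫ τ in t..s, (y τ)⁻ := fun hts =>
      intervalIntegral.integral_nonneg hts fun _ _ => negPart_nonneg _
    have hderiv : ∀ t ∈ interior (Set.Icc 0 x),
        -(M * ∫ τ in (0 : ℝ)..x, (y τ)⁻) ≤ deriv y t := by
      intro t ht
      rw [interior_Icc] at ht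
      refine (neg_le_neg (mul_le_mul_of_nonneg_left ?_ hM0.le)).trans
        (hy.neg_integral_negPart_le_deriv hM (hV.locallyIntegrable le_top) hneg h1 ht.1.le)
      rw [← intervalIntegral.integral_add_adjacent_intervals (hcont.intervalIntegrable 0 t)
        (hcont.intervalIntegrable t x)]
      exact le_add_of_nonneg_right (hint ht.2.le)
    have hmean := (convex_Icc 0 x).mul_sub_le_image_sub_of_le_deriv hy.continuous.continuousOn
      hy.1.differentiableOn hderiv 0 ⟨le_rfl, hx.1⟩ x ⟨hx.1, le_rfl⟩ hx.1
    have hnonneg := mul_nonneg hM0.le (hint hx.1)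
    have hmono := mul_le_mul_of_nonneg_right hx.2 hnonneg
    exact sup_le (by linarith) (by nlinarith)
  exact negPart_eq_zero.1 (eq_zero_of_le_mul_integral hcont (fun _ _ => negPart_nonneg _)
    hgronwall ⟨hR, le_rfl⟩)

theorem add_mul_le (hV : MemLp V ⊤ volume) (hneg : ∀ᵐ t : ℝ, V t ≤ 0) (hy : IsHillSolution V y)
    (h0 : 0 ≤ y 0) (h1 : 0 ≤ deriv y 0) {x : ℝ} (hx : 0 ≤ x) : y 0 + deriv y 0 * x ≤ y x := by
  have hmean := (convex_Icc 0 x).mul_sub_le_image_sub_of_le_deriv hy.continuous.continuousOn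
    hy.1.differentiableOn (fun t ht => hy.le_deriv hneg (interior_subset ht).1 fun s hs =>
      hy.nonneg hV hneg h0 h1 hs.1) 0 ⟨le_rfl, hx⟩ x ⟨hx, le_rfl⟩ hx
  linarith

end NonpositivePotential

section Growing

variable {V : ℝ → ℝ} {T l : ℝ}

theorem deriv_add_of_growing {y : ℝ → ℝ} (hper : ∀ t, y (t + T) = l * y t) (x : ℝ) :
    deriv y (x + T) = l * deriv y x := by
  rw [← deriv_comp_add_const, funext hper, deriv_const_mul_field]

theorem deriv_mul_self_nonneg_of_growing (hV : LocallyIntegrable V) (hneg : ∀ᵐ t : ℝ, V t ≤ 0)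
    (hT : 0 ≤ T) (hl : 1 < l) {y : ℝ → ℝ} (hy : IsHillSolution V y)
    (hper : ∀ t, y (t + T) = l * y t) (x : ℝ) : 0 ≤ deriv y x * y x := by
  have hmono := hy.monotone_deriv_mul_self hV hneg (le_add_of_nonneg_right hT : x ≤ x + T)
  have hderiv := deriv_add_of_growing hper x
  simp only [hper, hderiv] at hmono
  have hl2 : 0 < l ^ 2 - 1 := by nlinarith
  refine nonneg_of_mul_nonneg_right (a := l ^ 2 - 1) ?_ hl2
  linear_combination hmono

theorem deriv_mul_self_pos_of_growing (hV : LocallyIntegrable V) (hneg : ∀ᵐ t : ℝ, V t ≤ 0)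
    (hT : 0 ≤ T) (hl : 1 < l) {y : ℝ → ℝ} (hy : IsHillSolution V y)
    (hper : ∀ t, y (t + T) = l * y t) {x : ℝ} (hx : y x ≠ 0) : 0 < deriv y x * y x := by
  have hnonneg := hy.deriv_mul_self_nonneg_of_growing hV hneg hT hl hper
  refine (hnonneg x).lt_of_ne' fun hzero => ?_
  have hderiv := deriv_add_of_growing hper x
  have hvanish : ∀ t ∈ Set.Icc x (x + T), deriv y t * y t = 0 := fun t ht => by
    refine le_antisymm ?_ (hnonneg t)
    have hmono := hy.monotone_deriv_mul_self hV hneg ht.2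
    simp only [hper, hderiv] at hmono
    linear_combination hmono + l ^ 2 * hzero.le
  have hconst : y (x + T) ^ 2 = y x ^ 2 := by
    refine constant_of_has_deriv_right_zero (hy.continuous.pow 2).continuousOn (fun t ht => ?_)
      (x + T) ⟨le_add_of_nonneg_right hT, le_rfl⟩
    refine (((hy.hasDerivAt t).pow 2).congr_deriv ?_).hasDerivWithinAt
    linear_combination 2 * hvanish t (Set.Ico_subset_Icc_self ht)
  rw [hper, mul_pow, mul_eq_right₀ (pow_ne_zero 2 hx)] at hconst
  nlinarith

theorem abs_deriv_le_of_growing (hV : LocallyIntegrable V) (hneg : ∀ᵐ t : ℝ, V t ≤ 0) {K : ℝ}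
    (hK0 : 0 ≤ K) (hK : ∀ᵐ t : ℝ, -K ^ 2 ≤ V t) (hT : 0 ≤ T) (hl : 1 < l) {y : ℝ → ℝ}
    (hy : IsHillSolution V y) (hper : ∀ t, y (t + T) = l * y t) (x : ℝ) :
    |deriv y x| ≤ K * |y x| := by
  have henergy := hy.sq_deriv_sub_sq_le hV hK (le_add_of_nonneg_right hT : x ≤ x + T)
    fun t _ => hy.deriv_mul_self_nonneg_of_growing hV hneg hT hl hper t
  have hderiv := deriv_add_of_growing hper x
  rw [hper, hderiv] at henergy
  have hl2 : 0 < l ^ 2 - 1 := by nlinarith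
  refine abs_le_of_sq_le_sq (le_of_mul_le_mul_left (a := l ^ 2 - 1) ?_ hl2) (by positivity)
  rw [mul_pow K, sq_abs]
  linear_combination henergy

/-- The real solutions `Re (u / u(x))` and `Im (u / u(x))` equal `1` and `0` at `x`. -/
theorem logDeriv_of_growing (hV : LocallyIntegrable V) (hneg : ∀ᵐ t : ℝ, V t ≤ 0) {K : ℝ}
    (hK0 : 0 ≤ K) (hK : ∀ᵐ t : ℝ, -K ^ 2 ≤ V t) (hT : 0 ≤ T) (hl : 1 < l) {u : ℝ → ℂ}
    (hu : IsHillSolution V u) (hper : ∀ t, u (t + T) = l * u t) {x : ℝ} (hx : u x ≠ 0) :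
    (deriv u x / u x).im = 0 ∧ 0 < (deriv u x / u x).re ∧ (deriv u x / u x).re ≤ K := by
  let w : ℝ → ℂ := fun t => (u x)⁻¹ * u t
  have hw : IsHillSolution V w := hu.clm_comp hV (ContinuousLinearMap.mul ℝ ℂ (u x)⁻¹)
  have hwx : w x = 1 := inv_mul_cancel₀ hx
  have hderiv : deriv w x = deriv u x / u x := by
    rw [deriv_const_mul_field, div_eq_inv_mul]
  have hwper : ∀ t, w (t + T) = l * w t := fun t => by
    simp only [w, hper]
    ring
  have hre := hw.clm_comp hV Complex.reCLM
  have him := hw.clm_comp hV Complex.imCLM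
  have hreper : ∀ t, Complex.reCLM (w (t + T)) = l * Complex.reCLM (w t) := fun t => by simp [hwper]
  have himper : ∀ t, Complex.imCLM (w (t + T)) = l * Complex.imCLM (w t) := fun t => by simp [hwper]
  have hrederiv := (Complex.reCLM.hasFDerivAt.comp_hasDerivAt x (hw.hasDerivAt x)).deriv
  have himderiv := (Complex.imCLM.hasFDerivAt.comp_hasDerivAt x (hw.hasDerivAt x)).deriv
  have hreK := hre.abs_deriv_le_of_growing hV hneg hK0 hK hT hl hreper x
  have himK := him.abs_deriv_le_of_growing hV hneg hK0 hK hT hl himper x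
  have hrepos := hre.deriv_mul_self_pos_of_growing hV hneg hT hl hreper (x := x) (by simp [hwx])
  simp only [Function.comp_def] at hrederiv himderiv
  rw [hrederiv, hderiv] at hreK hrepos
  rw [himderiv, hderiv] at himK
  simp only [Complex.reCLM_apply, Complex.imCLM_apply, hwx, Complex.one_re, Complex.one_im,
    abs_one, abs_zero, mul_one, mul_zero] at hreK himK hrepos
  exact ⟨abs_nonpos_iff.1 himK, hrepos, (le_abs_self _).trans hreK⟩

end Growing

end IsHillSolution

namespace GratingProblem

variable (S : GratingProblem)

/-! ### Downward modes of high order -/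

theorem memLp_hillPotential (n : ℤ) : MemLp (S.hillPotential n) ⊤ volume :=
  (S.q_bounded.const_mul (S.k ^ 2)).sub (memLp_top_const _)

theorem locallyIntegrable_hillPotential (n : ℤ) : LocallyIntegrable (S.hillPotential n) :=
  (S.memLp_hillPotential n).locallyIntegrable le_top

theorem periodic_hillPotential (n : ℤ) : Function.Periodic (S.hillPotential n) (2 * Real.pi) :=
  fun t => by simp only [hillPotential, S.q_periodic t]

theorem neg_sq_le_hillPotential (n : ℤ) : ∀ᵐ t : ℝ, -|S.α n| ^ 2 ≤ S.hillPotential n t := by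
  filter_upwards [S.q_pos] with t ht
  rw [sq_abs, hillPotential]
  have := mul_nonneg (sq_nonneg S.k) ht.le
  linarith

theorem tendsto_abs_α : Tendsto (fun n : ℤ => |S.α n|) cofinite atTop := by
  have hc : 0 < 2 * Real.pi / S.p := div_pos Real.two_pi_pos S.p_pos
  have hlin : Tendsto (fun n : ℤ => 2 * Real.pi / S.p * |(n : ℝ)| - |S.αhat|) cofinite atTop :=
    tendsto_atTop_add_const_right _ _ (Tendsto.const_mul_atTop hc
      (tendsto_norm_cocompact_atTop.comp Int.tendsto_coe_cofinite))
  refine tendsto_atTop_mono (fun n => ?_) hlin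
  have h := abs_sub_abs_le_abs_sub (2 * Real.pi / S.p * n) (-S.αhat)
  rwa [abs_neg, abs_mul, abs_of_pos hc, sub_neg_eq_add, add_comm (_ * _)] at h

theorem exists_le_abs_α (R : ℝ) : ∃ N : ℕ, ∀ n : ℤ, (N : ℤ) < |n| → R ≤ |S.α n| := by
  obtain ⟨N, hN⟩ := ((eventually_cofinite.1
    (S.tendsto_abs_α.eventually_ge_atTop R)).image Int.natAbs).bddAbove
  refine ⟨N, fun n hn => ?_⟩
  by_contra h
  have : n.natAbs ≤ N := hN ⟨n, h, rfl⟩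
  rw [Int.abs_eq_natAbs] at hn
  omega

theorem exists_hillPotential_neg : ∃ N : ℕ, ∀ n : ℤ, (N : ℤ) < |n| →
    ∀ᵐ t : ℝ, S.hillPotential n t < 0 := by
  obtain ⟨M, hM0, hM⟩ := exists_ae_norm_le_of_memLp_top S.q_bounded
  obtain ⟨N, hN⟩ := S.exists_le_abs_α (S.k ^ 2 * M + 1)
  refine ⟨N, fun n hn => ?_⟩
  have hk : 0 ≤ S.k ^ 2 * M := by positivity
  have hα : S.k ^ 2 * M < S.α n ^ 2 := by
    rw [← sq_abs (S.α n)]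
    nlinarith [hN n hn]
  filter_upwards [hM] with t ht
  rw [hillPotential, sub_neg]
  exact (mul_le_mul_of_nonneg_left ((Real.le_norm_self _).trans ht) (sq_nonneg _)).trans_lt hα

theorem w₁_spec (n : ℤ) :
    IsHillSolution (S.hillPotential n) (S.w₁ n) ∧ S.w₁ n 0 = 1 ∧ deriv (S.w₁ n) 0 = 0 :=
  Classical.epsilon_spec (exists_isHillSolution (S.memLp_hillPotential n) 1 0)

theorem w₂_spec (n : ℤ) :
    IsHillSolution (S.hillPotential n) (S.w₂ n) ∧ S.w₂ n 0 = 0 ∧ deriv (S.w₂ n) 0 = 1 :=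
  Classical.epsilon_spec (exists_isHillSolution (S.memLp_hillPotential n) 0 1)

variable {S}
variable {n : ℤ}

theorem one_le_w₁ (hn : ∀ᵐ t : ℝ, S.hillPotential n t ≤ 0) {x : ℝ} (hx : 0 ≤ x) :
    1 ≤ S.w₁ n x := by
  obtain ⟨hw, hw0, hw1⟩ := S.w₁_spec n
  simpa [hw0, hw1] using hw.add_mul_le (S.memLp_hillPotential n) hn (by simp [hw0]) hw1.ge hx

theorem le_w₂ (hn : ∀ᵐ t : ℝ, S.hillPotential n t ≤ 0) {x : ℝ} (hx : 0 ≤ x) :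
    x ≤ S.w₂ n x := by
  obtain ⟨hw, hw0, hw1⟩ := S.w₂_spec n
  simpa [hw0, hw1] using hw.add_mul_le (S.memLp_hillPotential n) hn hw0.ge (by simp [hw1]) hx

theorem deriv_w₁_pos (hn : ∀ᵐ t : ℝ, S.hillPotential n t < 0) {x : ℝ} (hx : 0 < x) :
    0 < deriv (S.w₁ n) x := by
  obtain ⟨hw, -, hw1⟩ := S.w₁_spec n
  rw [← hw1]
  exact hw.lt_deriv (S.locallyIntegrable_hillPotential n) hn hx fun t ht =>
    one_pos.trans_le (one_le_w₁ (hn.mono fun _ => le_of_lt) ht.1.le)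

theorem one_lt_deriv_w₂ (hn : ∀ᵐ t : ℝ, S.hillPotential n t < 0) {x : ℝ} (hx : 0 < x) :
    1 < deriv (S.w₂ n) x := by
  obtain ⟨hw, -, hw1⟩ := S.w₂_spec n
  rw [← hw1]
  exact hw.lt_deriv (S.locallyIntegrable_hillPotential n) hn hx fun t ht =>
    ht.1.trans_le (le_w₂ (hn.mono fun _ => le_of_lt) ht.1.le)

theorem two_lt_η (hn : ∀ᵐ t : ℝ, S.hillPotential n t < 0) : 2 < S.η n := by
  have h₁ := one_le_w₁ (hn.mono fun _ => le_of_lt) Real.two_pi_pos.le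
  have h₂ := one_lt_deriv_w₂ hn Real.two_pi_pos
  rw [η]
  linarith

end GratingProblem

/-- The eigenvalue equation of the matrix with rows `(a, b)` and `(c, d)`. -/
theorem exists_gt_sub_mul_sub_eq (a d : ℝ) {e : ℝ} (he : 0 < e) :
    ∃ l, a < l ∧ (l - a) * (l - d) = e := by
  have hdisc : 0 ≤ (a - d) ^ 2 + 4 * e := by positivity
  refine ⟨(a + d + √((a - d) ^ 2 + 4 * e)) / 2, ?_, ?_⟩
  · have : a - d < √((a - d) ^ 2 + 4 * e) := Real.lt_sqrt_of_sq_lt (by linarith)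
    linarith
  · linear_combination Real.sq_sqrt hdisc / 4

namespace GratingProblem

variable {S : GratingProblem} {n : ℤ}

/-- The real solution with initial values `(wₙ₂(2π), l - wₙ₁(2π))`, which is an eigenvector of
`Wₙ` when `l` is an eigenvalue. -/
def floquetSolution (S : GratingProblem) (n : ℤ) (l t : ℝ) : ℝ :=
  S.w₂ n (2 * Real.pi) * S.w₁ n t + (l - S.w₁ n (2 * Real.pi)) * S.w₂ n t

theorem isHillSolution_floquetSolution (n : ℤ) (l : ℝ) :
    IsHillSolution (S.hillPotential n) (S.floquetSolution n l) :=
  ((S.w₁_spec n).1.const_smul _).add (S.locallyIntegrable_hillPotential n)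
    ((S.w₂_spec n).1.const_smul _)

theorem deriv_floquetSolution (n : ℤ) (l t : ℝ) : deriv (S.floquetSolution n l) t
    = S.w₂ n (2 * Real.pi) * deriv (S.w₁ n) t
      + (l - S.w₁ n (2 * Real.pi)) * deriv (S.w₂ n) t :=
  ((((S.w₁_spec n).1.hasDerivAt t).const_mul _).add
    (((S.w₂_spec n).1.hasDerivAt t).const_mul _)).deriv

theorem floquetSolution_zero (n : ℤ) (l : ℝ) :
    S.floquetSolution n l 0 = S.w₂ n (2 * Real.pi) := by
  rw [floquetSolution, (S.w₁_spec n).2.1, (S.w₂_spec n).2.1]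
  ring

theorem floquetSolution_add_two_pi {l : ℝ}
    (hl : (l - S.w₁ n (2 * Real.pi)) * (l - deriv (S.w₂ n) (2 * Real.pi))
      = S.w₂ n (2 * Real.pi) * deriv (S.w₁ n) (2 * Real.pi))
    (t : ℝ) :
    S.floquetSolution n l (t + 2 * Real.pi) = l * S.floquetSolution n l t := by
  have hy := S.isHillSolution_floquetSolution n l
  have hshift := hy.comp_add_period (S.locallyIntegrable_hillPotential n)
    (S.periodic_hillPotential n)
  refine congrFun (hshift.ext_of_initial (S.memLp_hillPotential n) (hy.const_smul l) ?_ ?_) t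
  · rw [floquetSolution_zero, floquetSolution, zero_add, smul_eq_mul]
    ring
  · rw [deriv_comp_add_const, deriv_fun_const_smul_field, deriv_floquetSolution,
      deriv_floquetSolution, (S.w₁_spec n).2.2, (S.w₂_spec n).2.2, zero_add, smul_eq_mul]
    linear_combination -hl

theorem isCharacteristicMultiplier_of_root {l : ℝ}
    (hl : (l - S.w₁ n (2 * Real.pi)) * (l - deriv (S.w₂ n) (2 * Real.pi))
      = S.w₂ n (2 * Real.pi) * deriv (S.w₁ n) (2 * Real.pi))
    (hw₂ : S.w₂ n (2 * Real.pi) ≠ 0) :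
    S.IsCharacteristicMultiplier n l := by
  refine Module.End.hasEigenvalue_of_hasEigenvector
    (x := ![(S.w₂ n (2 * Real.pi) : ℂ), ((l - S.w₁ n (2 * Real.pi) : ℝ) : ℂ)])
    ⟨Module.End.mem_eigenspace_iff.2 ?_, fun h => ?_⟩
  · have hlC := congrArg Complex.ofReal hl
    push_cast at hlC
    rw [Matrix.toLin'_apply]
    ext i
    fin_cases i
    · simp [monodromy, Matrix.mulVec, dotProduct]
      ring
    · simp [monodromy, Matrix.mulVec, dotProduct]
      linear_combination -hlC
  · exact hw₂ (by simpa using congrFun h 0)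

theorem exists_isDownwardMode (hn : ∀ᵐ t : ℝ, S.hillPotential n t < 0) :
    ∃ u, S.IsDownwardMode n u := by
  have hw₁ := one_le_w₁ (hn.mono fun _ => le_of_lt) Real.two_pi_pos.le
  have hw₂ := Real.two_pi_pos.trans_le (le_w₂ (hn.mono fun _ => le_of_lt) Real.two_pi_pos.le)
  obtain ⟨l, hl, hroot⟩ := exists_gt_sub_mul_sub_eq (S.w₁ n (2 * Real.pi))
    (deriv (S.w₂ n) (2 * Real.pi)) (mul_pos hw₂ (deriv_w₁_pos hn Real.two_pi_pos))
  have hl1 : 1 < l := hw₁.trans_lt hl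
  let μ := Real.log l / (2 * Real.pi)
  have hexp : Real.exp (2 * Real.pi * μ) = l := by
    rw [mul_div_cancel₀ _ Real.two_pi_pos.ne', Real.exp_log (one_pos.trans hl1)]
  have hexpC : Complex.exp (2 * Real.pi * μ) = l := by exact_mod_cast congrArg Complex.ofReal hexp
  let v : ℝ → ℂ := fun t => Complex.exp (-(μ * t)) * S.floquetSolution n l t
  have hper : Function.Periodic v (2 * Real.pi) := fun t => by
    simp only [v, floquetSolution_add_two_pi hroot]
    push_cast
    rw [← hexpC, ← mul_assoc, ← Complex.exp_add]
    ring_nf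
  refine ⟨fun t => S.floquetSolution n l t, fun h => hw₂.ne' ?_,
    (S.isHillSolution_floquetSolution n l).clm_comp (S.locallyIntegrable_hillPotential n)
      Complex.ofRealCLM, μ, v, Or.inl ⟨two_lt_η hn, μ,
      div_pos (Real.log_pos hl1) Real.two_pi_pos, ?_, rfl⟩, hper, fun t => ?_⟩
  · simpa [floquetSolution_zero] using congrFun h 0
  · rw [hexp]
    exact isCharacteristicMultiplier_of_root hroot hw₂.ne'
  · rw [← mul_assoc, ← Complex.exp_add, add_neg_cancel, Complex.exp_zero, one_mul]

theorem IsDownwardExponent.exists_eq_ofReal (hη : 2 < S.η n) {m : ℂ}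
    (hm : S.IsDownwardExponent n m) : ∃ μ : ℝ, 0 < μ ∧ m = μ := by
  rcases hm with ⟨-, μ, hμ, -, h⟩ | ⟨h, -⟩ | ⟨h, -⟩ | ⟨h, -⟩ | ⟨h, -⟩
  · exact ⟨μ, hμ, h⟩
  · linarith
  · linarith [(abs_lt.1 h).2]
  · linarith
  · linarith

theorem downwardCoefficient_of_hillPotential_neg (hn : ∀ᵐ t : ℝ, S.hillPotential n t < 0)
    (hb : S.downwardMode n S.b ≠ 0) :
    (S.downwardCoefficient n).im = 0 ∧ (S.downwardCoefficient n).re < 0 ∧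
      -|S.α n| ≤ (S.downwardCoefficient n).re := by
  obtain ⟨-, hu, m, v, hm, hv, huv⟩ : S.IsDownwardMode n (S.downwardMode n) :=
    Classical.epsilon_spec (exists_isDownwardMode hn)
  obtain ⟨μ, hμ, rfl⟩ := hm.exists_eq_ofReal (two_lt_η hn)
  have hper : ∀ t, S.downwardMode n (t + 2 * Real.pi)
      = Real.exp (μ * (2 * Real.pi)) * S.downwardMode n t := fun t => by
    rw [huv, huv, hv t, ← mul_assoc]
    push_cast
    rw [← Complex.exp_add]
    ring_nf
  obtain ⟨him, hre, hle⟩ := hu.logDeriv_of_growing (S.locallyIntegrable_hillPotential n)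
    (hn.mono fun _ => le_of_lt) (abs_nonneg (S.α n)) (S.neg_sq_le_hillPotential n)
    Real.two_pi_pos.le (Real.one_lt_exp_iff.2 (by positivity)) hper hb
  rw [downwardCoefficient, Complex.neg_im, Complex.neg_re, him]
  exact ⟨neg_zero, neg_neg_of_pos hre, neg_le_neg hle⟩

end GratingProblem

/-! ### Weak derivatives on an interval -/

section Interval

variable {E : Type*} [NormedAddCommGroup E] [NormedSpace ℝ E] {b d : ℝ} {f g : ℝ → E}

theorem integrableOn_continuous_smul {ρ : ℝ → ℝ} (hρ : Continuous ρ)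
    (hg : IntegrableOn g (Set.Ioo b d)) : IntegrableOn (fun t => ρ t • g t) (Set.Ioo b d) :=
  hg.continuousOn_smul_of_subset hρ.continuousOn isCompact_Icc measurableSet_Ioo
    Set.Ioo_subset_Icc_self

theorem integral_deriv_smul_integral [CompleteSpace E] (hbd : b ≤ d)
    (hg : IntegrableOn g (Set.Ioo b d)) {ρ : ℝ → ℝ} (hρ : ContDiff ℝ 1 ρ) :
    ∫ t in b..d, deriv ρ t • ∫ s in b..t, g s
      = ρ d • (∫ s in b..d, g s) - ∫ s in b..d, ρ s • g s := by
  have hdρ : Continuous (deriv ρ) := hρ.continuous_deriv le_rfl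
  have hρg : IntegrableOn (fun s => ρ s • g s) (Set.Ioc b d) :=
    (integrableOn_Ioc_iff_integrableOn_Ioo (by simp)).2
      (integrableOn_continuous_smul hρ.continuous hg)
  replace hg : IntegrableOn g (Set.Ioc b d) :=
    (integrableOn_Ioc_iff_integrableOn_Ioo (by simp)).2 hg
  let F : ℝ → ℝ → E := fun t s => (Set.Ici s).indicator (deriv ρ) t • g s
  have hF : Integrable (Function.uncurry F)
      ((volume.restrict (Set.Ioc b d)).prod (volume.restrict (Set.Ioc b d))) := by
    have h : Integrable (fun x : ℝ × ℝ => deriv ρ x.1 • g x.2)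
        ((volume.restrict (Set.Ioc b d)).prod (volume.restrict (Set.Ioc b d))) :=
      (hdρ.integrableOn_Ioc (μ := volume)).smul_prod hg
    refine (h.indicator (measurableSet_le measurable_snd measurable_fst)).congr
      (ae_of_all _ fun x => ?_)
    by_cases hx : x.2 ≤ x.1 <;> simp [F, Function.uncurry, Set.indicator, hx]
  have inner_s : ∀ t ∈ Set.Ioc b d, deriv ρ t • ∫ s in b..t, g s = ∫ s in Set.Ioc b d, F t s := by
    intro t ht
    have h : ∀ s, F t s = (Set.Iic t).indicator (fun s => deriv ρ t • g s) s := fun s => by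
      by_cases hs : s ≤ t <;> simp [F, Set.indicator, hs]
    simp only [h]
    rw [setIntegral_indicator measurableSet_Iic, Set.Ioc_inter_Iic, min_eq_right ht.2,
      integral_smul, intervalIntegral.integral_of_le ht.1.le]
  have inner_t : ∀ s ∈ Set.Ioc b d, ∫ t in Set.Ioc b d, F t s = ρ d • g s - ρ s • g s := by
    intro s hs
    have hFTC := intervalIntegral.integral_deriv_eq_sub
      (fun t _ => hρ.differentiable one_ne_zero t) (hdρ.intervalIntegrable s d)
    rw [integral_smul_const, setIntegral_indicator measurableSet_Ici,
      show Set.Ioc b d ∩ Set.Ici s = Set.Icc s d by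
        ext t; exact ⟨fun h => ⟨h.2, h.1.2⟩, fun h => ⟨⟨hs.1.trans_le h.1, h.2⟩, h.1⟩⟩,
      integral_Icc_eq_integral_Ioc, ← intervalIntegral.integral_of_le hs.2, hFTC, sub_smul]
  rw [intervalIntegral.integral_of_le hbd, intervalIntegral.integral_of_le hbd,
    intervalIntegral.integral_of_le hbd, setIntegral_congr_fun measurableSet_Ioc inner_s,
    integral_integral_swap hF, setIntegral_congr_fun measurableSet_Ioc inner_t,
    integral_sub (hg.fun_smul _) hρg, integral_smul]

/-- `g` is the weak derivative of `f` on the interval `(b, d)`. -/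
def IsWeakDerivOn (b d : ℝ) (f g : ℝ → E) : Prop :=
  ∀ φ : ℝ → ℝ, ContDiff ℝ ∞ φ → HasCompactSupport φ → tsupport φ ⊆ Set.Ioo b d →
    ∫ t in Set.Ioo b d, deriv φ t • f t = -∫ t in Set.Ioo b d, φ t • g t

theorem isWeakDerivOn_integral [CompleteSpace E] (hbd : b ≤ d)
    (hg : IntegrableOn g (Set.Ioo b d)) :
    IsWeakDerivOn b d (fun t => ∫ s in b..t, g s) g := by
  intro φ hφ _ hsupp
  have h := integral_deriv_smul_integral hbd hg (hφ.of_le (by simp))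
  rwa [image_eq_zero_of_notMem_tsupport fun hd => (hsupp hd).2.false, zero_smul, zero_sub,
    intervalIntegral.integral_of_le hbd, intervalIntegral.integral_of_le hbd,
    integral_Ioc_eq_integral_Ioo, integral_Ioc_eq_integral_Ioo] at h

theorem exists_Icc_superset_of_subset_Ioo {K : Set ℝ} (hK : IsCompact K) (hbd : b < d)
    (hKbd : K ⊆ Set.Ioo b d) : ∃ b' d', b < b' ∧ d' < d ∧ K ⊆ Set.Icc b' d' := by
  rcases K.eq_empty_or_nonempty with rfl | hne
  · exact ⟨d, b, hbd, hbd, Set.empty_subset _⟩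
  · obtain ⟨b', hb', hmin⟩ := hK.exists_isLeast hne
    obtain ⟨d', hd', hmax⟩ := hK.exists_isGreatest hne
    exact ⟨b', d', (hKbd hb').1, (hKbd hd').2, fun t ht => ⟨hmin ht, hmax ht⟩⟩

theorem exists_primitive_of_integral_eq_zero (hbd : b < d) {ψ : ℝ → ℝ} (hψ : ContDiff ℝ ∞ ψ)
    (hc : HasCompactSupport ψ) (hsupp : tsupport ψ ⊆ Set.Ioo b d) (h0 : ∫ t, ψ t = 0) :
    ∃ φ : ℝ → ℝ, ContDiff ℝ ∞ φ ∧ HasCompactSupport φ ∧ tsupport φ ⊆ Set.Ioo b d ∧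
      deriv φ = ψ := by
  obtain ⟨b', d', hb', hd', hK⟩ := exists_Icc_superset_of_subset_Ioo hc hbd hsupp
  have hzero : ∀ t ∉ Set.Icc b' d', ψ t = 0 := fun t ht =>
    image_eq_zero_of_notMem_tsupport fun h => ht (hK h)
  have hderiv : ∀ t, HasDerivAt (fun t => ∫ s in b..t, ψ s) (ψ t) t := fun t =>
    (hψ.continuous.integral_hasStrictDerivAt b t).hasDerivAt
  have hφ0 : ∀ t ∉ Set.Icc b' d', ∫ s in b..t, ψ s = 0 := by
    intro t ht
    rcases le_or_gt b' t with hbt | htb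
    · rw [← h0, intervalIntegral.integral_of_le (hb'.le.trans hbt)]
      refine setIntegral_eq_integral_of_forall_compl_eq_zero fun s hs => hzero s fun h => ?_
      exact hs ⟨hb'.trans_le h.1, h.2.trans (not_le.1 fun h' => ht ⟨hbt, h'⟩).le⟩
    · refine intervalIntegral.integral_zero_ae (ae_of_all _ fun s hs => hzero s fun h => ?_)
      exact (h.1.trans hs.2).not_gt (max_lt hb' htb)
  have hts : tsupport (fun t => ∫ s in b..t, ψ s) ⊆ Set.Icc b' d' :=
    closure_minimal (fun t ht => by_contra fun h => ht (hφ0 t h)) isClosed_Icc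
  have heq : deriv (fun t => ∫ s in b..t, ψ s) = ψ := funext fun t => (hderiv t).deriv
  exact ⟨_, contDiff_infty_iff_deriv.2 ⟨fun t => (hderiv t).differentiableAt, heq.symm ▸ hψ⟩,
    isCompact_Icc.of_isClosed_subset (isClosed_tsupport _) hts,
    hts.trans fun t ht => ⟨hb'.trans_le ht.1, ht.2.trans_lt hd'⟩, heq⟩

theorem ae_eq_const_of_integral_contDiff_smul_eq [CompleteSpace E] {c : E}
    (hf : IntegrableOn f (Set.Ioo b d))
    (h : ∀ ψ : ℝ → ℝ, ContDiff ℝ ∞ ψ → HasCompactSupport ψ → tsupport ψ ⊆ Set.Ioo b d →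
      ∫ t in Set.Ioo b d, ψ t • f t = (∫ t, ψ t) • c) :
    ∀ᵐ t ∂volume.restrict (Set.Ioo b d), f t = c := by
  have hfc : IntegrableOn (fun t => f t - c) (Set.Ioo b d) :=
    hf.sub (integrableOn_const measure_Ioo_lt_top.ne)
  rw [ae_restrict_iff' measurableSet_Ioo]
  refine (isOpen_Ioo.ae_eq_zero_of_integral_contDiff_smul_eq_zero hfc.locallyIntegrableOn
    fun ψ hψ hψc hψsupp => ?_).mono fun t ht hmem => sub_eq_zero.1 (ht hmem)
  have hψ0 : ∀ t ∉ Set.Ioo b d, ψ t = 0 := fun t ht =>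
    image_eq_zero_of_notMem_tsupport fun h => ht (hψsupp h)
  have hψi : Integrable ψ := hψ.continuous.integrable_of_hasCompactSupport hψc
  rw [← setIntegral_eq_integral_of_forall_compl_eq_zero fun t ht => by rw [hψ0 t ht, zero_smul]]
  simp only [smul_sub]
  rw [integral_sub (integrableOn_continuous_smul hψ.continuous hf)
    (hψi.integrableOn.smul_const c), h ψ hψ hψc hψsupp, integral_smul_const,
    setIntegral_eq_integral_of_forall_compl_eq_zero hψ0, sub_self]

theorem IsWeakDerivOn.exists_ae_eq_const [CompleteSpace E] (hbd : b < d)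
    (hf : IntegrableOn f (Set.Ioo b d)) (h : IsWeakDerivOn b d f 0) :
    ∃ c, ∀ᵐ t ∂volume.restrict (Set.Ioo b d), f t = c := by
  let bump : ContDiffBump ((b + d) / 2) := ⟨(d - b) / 8, (d - b) / 4, by linarith, by linarith⟩
  let η := bump.normed volume
  have hη : ContDiff ℝ ∞ η := bump.contDiff_normed
  have hηc : HasCompactSupport η := bump.hasCompactSupport_normed
  have hηsupp : tsupport η ⊆ Set.Ioo b d := by
    rw [bump.tsupport_normed_eq, Real.closedBall_eq_Icc]
    exact Set.Icc_subset_Ioo (by change _ < _ - (d - b) / 4; linarith)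
      (by change _ + (d - b) / 4 < _; linarith)
  refine ⟨∫ t in Set.Ioo b d, η t • f t, ae_eq_const_of_integral_contDiff_smul_eq hf
    fun ψ hψ hψc hψsupp => ?_⟩
  let m := ∫ t, ψ t
  have hmean : ∫ t, (ψ t - m * η t) = 0 := by
    rw [integral_sub (hψ.continuous.integrable_of_hasCompactSupport hψc)
      ((hη.continuous.integrable_of_hasCompactSupport hηc).const_mul m), integral_const_mul,
      bump.integral_normed, mul_one, sub_self]
  obtain ⟨φ, hφ, hφc, hφsupp, hφψ⟩ := exists_primitive_of_integral_eq_zero hbd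
    (hψ.sub (contDiff_const.mul hη)) (hψc.sub hηc.mul_left)
    ((tsupport_sub _ _).trans (Set.union_subset hψsupp ((tsupport_mul_subset_right).trans hηsupp)))
    hmean
  have h1 := h φ hφ hφc hφsupp
  simp only [hφψ, Pi.zero_apply, smul_zero, integral_zero, neg_zero, sub_smul, mul_smul] at h1
  rwa [integral_sub (integrableOn_continuous_smul hψ.continuous hf)
    ((integrableOn_continuous_smul hη.continuous hf).fun_smul m), integral_smul,
    sub_eq_zero] at h1

theorem IsWeakDerivOn.exists_ae_eq_add_integral [CompleteSpace E] (hbd : b < d)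
    (hf : IntegrableOn f (Set.Ioo b d)) (hg : IntegrableOn g (Set.Ioo b d))
    (h : IsWeakDerivOn b d f g) :
    ∃ c, ∀ᵐ t ∂volume.restrict (Set.Ioo b d), f t = c + ∫ s in b..t, g s := by
  let G : ℝ → E := fun t => ∫ s in b..t, g s
  have hG : IntegrableOn G (Set.Ioo b d) :=
    (intervalIntegral.continuousOn_primitive_interval (by
      rwa [Set.uIcc_of_le hbd.le, integrableOn_Icc_iff_integrableOn_Ioo (by simp) (by simp)])
      ).integrableOn_uIcc.mono_set (Set.Ioo_subset_Icc_self.trans Set.Icc_subset_uIcc)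
  have hconst : IsWeakDerivOn b d (fun t => f t - G t) 0 := by
    intro φ hφ hφc hφsupp
    have hφ' : Continuous (deriv φ) := hφ.continuous_deriv (by simp)
    simp only [smul_sub, Pi.zero_apply, smul_zero, integral_zero, neg_zero]
    rw [integral_sub (integrableOn_continuous_smul hφ' hf) (integrableOn_continuous_smul hφ' hG),
      h φ hφ hφc hφsupp, isWeakDerivOn_integral hbd.le hg φ hφ hφc hφsupp, sub_self]
  obtain ⟨c, hc⟩ := hconst.exists_ae_eq_const hbd (hf.sub hG)
  exact ⟨c, hc.mono fun t ht => sub_eq_iff_eq_add.1 ht⟩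

end Interval

theorem sq_norm_integral_le {X E : Type*} [MeasurableSpace X] [NormedAddCommGroup E]
    [NormedSpace ℝ E] {μ : Measure X} [IsFiniteMeasure μ] {f : X → E} (hf : MemLp f 2 μ) :
    ‖∫ x, f x ∂μ‖ ^ 2 ≤ μ.real Set.univ * ∫ x, ‖f x‖ ^ 2 ∂μ := by
  have h := integral_mul_norm_le_Lp_mul_Lq (μ := μ) (f := fun _ => (1 : ℝ)) (g := fun x => ‖f x‖)
    Real.HolderConjugate.two_two (memLp_const 1) (by simpa using hf.norm)
  simp only [norm_one, one_mul, norm_norm, one_pow, integral_const, smul_eq_mul, mul_one,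
    Real.rpow_two, ← Real.sqrt_eq_rpow] at h
  calc ‖∫ x, f x ∂μ‖ ^ 2
      ≤ (√(μ.real Set.univ) * √(∫ x, ‖f x‖ ^ 2 ∂μ)) ^ 2 := by
        gcongr
        exact (norm_integral_le_integral_norm f).trans h
    _ = μ.real Set.univ * ∫ x, ‖f x‖ ^ 2 ∂μ := by
        rw [mul_pow, Real.sq_sqrt measureReal_nonneg,
          Real.sq_sqrt (integral_nonneg fun x => sq_nonneg _)]

theorem sum_setIntegral_Ioo {E : Type*} [NormedAddCommGroup E] [NormedSpace ℝ E] {e : ℕ → ℝ}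
    (he : Monotone e) {m : ℕ} {f : ℝ → E} (hf : IntegrableOn f (Set.Ioo (e 0) (e m))) :
    ∑ j ∈ Finset.range m, ∫ t in Set.Ioo (e j) (e (j + 1)), f t
      = ∫ t in Set.Ioo (e 0) (e m), f t := by
  simp only [← integral_Ioc_eq_integral_Ioo, ← intervalIntegral.integral_of_le (he m.zero_le),
    ← intervalIntegral.integral_of_le (he (Nat.le_succ _))]
  refine intervalIntegral.sum_integral_adjacent_intervals fun j hj => ?_
  rw [intervalIntegrable_iff_integrableOn_Ioo_of_le (he j.le_succ)]
  exact hf.mono_set (Set.Ioo_subset_Ioo (he j.zero_le) (he hj))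

section Primitive

variable {E : Type*} [NormedAddCommGroup E] [NormedSpace ℝ E] {b d : ℝ} {f g : ℝ → E}

/-- `f` is an indefinite integral of `g` on `[b, d]`. -/
def IsPrimitiveOn (b d : ℝ) (f g : ℝ → E) : Prop :=
  ∀ s ∈ Set.Icc b d, ∀ t ∈ Set.Icc b d, f t - f s = ∫ x in s..t, g x

theorem isPrimitiveOn_const_add_integral (hg : IntegrableOn g (Set.Ioo b d)) (c : E) :
    IsPrimitiveOn b d (fun t => c + ∫ x in b..t, g x) g := by
  intro s hs t ht
  have h : ∀ r ∈ Set.Icc b d, IntervalIntegrable g volume b r := fun r hr => by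
    rw [intervalIntegrable_iff_integrableOn_Ioo_of_le hr.1]
    exact hg.mono_set (Set.Ioo_subset_Ioo_right hr.2)
  rw [add_sub_add_left_eq_sub, intervalIntegral.integral_interval_sub_left (h t ht) (h s hs)]

namespace IsPrimitiveOn

theorem mono (hfg : IsPrimitiveOn b d f g) {b' d' : ℝ} (hb : b ≤ b') (hd : d' ≤ d) :
    IsPrimitiveOn b' d' f g := fun s hs t ht =>
  hfg s (Set.Icc_subset_Icc hb hd hs) t (Set.Icc_subset_Icc hb hd ht)

theorem continuousOn (hfg : IsPrimitiveOn b d f g) (hbd : b ≤ d)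
    (hg : IntegrableOn g (Set.Ioo b d)) : ContinuousOn f (Set.Icc b d) := by
  have h : ContinuousOn (fun t => f b + ∫ x in b..t, g x) (Set.Icc b d) :=
    continuousOn_const.add (Set.uIcc_of_le hbd ▸ intervalIntegral.continuousOn_primitive_interval
      (by rwa [Set.uIcc_of_le hbd, integrableOn_Icc_iff_integrableOn_Ioo (by simp) (by simp)]))
  exact h.congr fun t ht => (add_eq_of_eq_sub' (hfg b ⟨le_rfl, hbd⟩ t ht).symm).symm

theorem sq_norm_sub_le (hfg : IsPrimitiveOn b d f g)
    (hg : MemLp g 2 (volume.restrict (Set.Ioo b d))) {s t : ℝ} (hs : s ∈ Set.Icc b d)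
    (ht : t ∈ Set.Icc b d) :
    ‖f t - f s‖ ^ 2 ≤ (d - b) * ∫ x in Set.Ioo b d, ‖g x‖ ^ 2 := by
  wlog hst : s ≤ t generalizing s t
  · rw [norm_sub_rev]
    exact this ht hs (le_of_not_ge hst)
  have hsub : Set.Ioo s t ⊆ Set.Ioo b d := Set.Ioo_subset_Ioo hs.1 ht.2
  have hb0 : 0 ≤ d - b := sub_nonneg.2 (hs.1.trans hs.2)
  rw [hfg s hs t ht, intervalIntegral.integral_of_le hst, integral_Ioc_eq_integral_Ioo]
  refine (sq_norm_integral_le (hg.mono_measure (Measure.restrict_mono_set _ hsub))).trans ?_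
  rw [measureReal_restrict_apply_univ, Real.volume_real_Ioo_of_le hst]
  exact mul_le_mul (sub_le_sub ht.2 hs.1)
    (setIntegral_mono_set (hg.integrable_norm_pow two_ne_zero) (ae_of_all _ fun x => by positivity)
      hsub.eventuallyLE) (integral_nonneg fun x => sq_nonneg _) hb0

theorem memLp (hfg : IsPrimitiveOn b d f g) (hbd : b ≤ d) (hg : IntegrableOn g (Set.Ioo b d)) :
    MemLp f 2 (volume.restrict (Set.Ioo b d)) := by
  have hf := hfg.continuousOn hbd hg
  obtain ⟨C, hC⟩ := isCompact_Icc.exists_bound_of_continuousOn hf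
  exact .of_bound ((hf.mono Set.Ioo_subset_Icc_self).aestronglyMeasurable measurableSet_Ioo) C
    (ae_restrict_of_forall_mem measurableSet_Ioo fun t ht => hC t (Set.Ioo_subset_Icc_self ht))

theorem length_mul_sq_norm_le (hfg : IsPrimitiveOn b d f g)
    (hg : MemLp g 2 (volume.restrict (Set.Ioo b d))) {e : ℝ} (he : e ∈ Set.Icc b d) :
    (d - b) * ‖f e‖ ^ 2 ≤ 2 * (∫ t in Set.Ioo b d, ‖f t‖ ^ 2)
      + 2 * (d - b) ^ 2 * ∫ t in Set.Ioo b d, ‖g t‖ ^ 2 := by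
  have hbd : b ≤ d := he.1.trans he.2
  have hf := (hfg.memLp hbd (hg.integrable one_le_two)).integrable_norm_pow two_ne_zero
  have hpt : ∀ t ∈ Set.Ioo b d,
      ‖f e‖ ^ 2 ≤ 2 * ‖f t‖ ^ 2 + 2 * ((d - b) * ∫ x in Set.Ioo b d, ‖g x‖ ^ 2) := by
    intro t ht
    have h1 := hfg.sq_norm_sub_le hg (Set.Ioo_subset_Icc_self ht) he
    have h2 : ‖f e‖ ≤ ‖f t‖ + ‖f e - f t‖ := norm_le_norm_add_norm_sub' _ _
    have h3 := add_sq_le (a := ‖f t‖) (b := ‖f e - f t‖)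
    nlinarith [pow_le_pow_left₀ (norm_nonneg _) h2 2]
  have h := setIntegral_mono_on (integrableOn_const measure_Ioo_lt_top.ne)
    ((hf.const_mul 2).add (integrableOn_const measure_Ioo_lt_top.ne)) measurableSet_Ioo hpt
  rw [integral_add' (hf.const_mul 2) (integrableOn_const measure_Ioo_lt_top.ne), integral_const_mul,
    setIntegral_const, setIntegral_const, Real.volume_real_Ioo_of_le hbd] at h
  simp only [smul_eq_mul] at h
  linarith

/-- Apply `length_mul_sq_norm_le` on a subinterval of length `(d - b) / l` around `e`. -/
theorem length_mul_mul_sq_norm_le (hfg : IsPrimitiveOn b d f g)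
    (hg : MemLp g 2 (volume.restrict (Set.Ioo b d))) {e : ℝ} (he : e ∈ Set.Icc b d) {l : ℝ}
    (hl : 1 ≤ l) :
    (d - b) * (l * ‖f e‖ ^ 2) ≤ 2 * (l ^ 2 * ∫ t in Set.Ioo b d, ‖f t‖ ^ 2)
      + 2 * (d - b) ^ 2 * ∫ t in Set.Ioo b d, ‖g t‖ ^ 2 := by
  have hl0 : 0 < l := one_pos.trans_le hl
  have hf := hfg.memLp (he.1.trans he.2) (hg.integrable one_le_two)
  have hb : b ≤ e - (e - b) / l := by linarith [div_le_self (sub_nonneg.2 he.1) hl]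
  have hd : e + (d - e) / l ≤ d := by linarith [div_le_self (sub_nonneg.2 he.2) hl]
  have hsub := Set.Ioo_subset_Ioo hb hd
  have h := (hfg.mono hb hd).length_mul_sq_norm_le
    (hg.mono_measure (Measure.restrict_mono_set _ hsub)) (e := e)
    ⟨by linarith [div_nonneg (sub_nonneg.2 he.1) hl0.le],
      by linarith [div_nonneg (sub_nonneg.2 he.2) hl0.le]⟩
  have hmono : ∀ {u : ℝ → E}, MemLp u 2 (volume.restrict (Set.Ioo b d)) →
      ∫ t in Set.Ioo (e - (e - b) / l) (e + (d - e) / l), ‖u t‖ ^ 2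
        ≤ ∫ t in Set.Ioo b d, ‖u t‖ ^ 2 := fun hu =>
    setIntegral_mono_set (hu.integrable_norm_pow two_ne_zero) (ae_of_all _ fun x => by positivity)
      hsub.eventuallyLE
  calc (d - b) * (l * ‖f e‖ ^ 2)
      = l ^ 2 * ((e + (d - e) / l - (e - (e - b) / l)) * ‖f e‖ ^ 2) := by field_simp; ring
    _ ≤ l ^ 2 * (2 * (∫ t in Set.Ioo b d, ‖f t‖ ^ 2)
        + 2 * (e + (d - e) / l - (e - (e - b) / l)) ^ 2 * ∫ t in Set.Ioo b d, ‖g t‖ ^ 2) := by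
      grw [h, hmono hf, hmono hg]
    _ = _ := by field_simp; ring

theorem integral_sq_norm_le (hfg : IsPrimitiveOn b d f g) (hbd : b ≤ d)
    (hg : MemLp g 2 (volume.restrict (Set.Ioo b d))) :
    ∫ t in Set.Ioo b d, ‖f t‖ ^ 2
      ≤ 2 * (d - b) * ‖f b‖ ^ 2 + 2 * (d - b) ^ 2 * ∫ t in Set.Ioo b d, ‖g t‖ ^ 2 := by
  have hf := (hfg.memLp hbd (hg.integrable one_le_two)).integrable_norm_pow two_ne_zero
  have hpt : ∀ t ∈ Set.Ioo b d,
      ‖f t‖ ^ 2 ≤ 2 * ‖f b‖ ^ 2 + 2 * ((d - b) * ∫ x in Set.Ioo b d, ‖g x‖ ^ 2) := by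
    intro t ht
    have h1 := hfg.sq_norm_sub_le hg ⟨le_rfl, hbd⟩ (Set.Ioo_subset_Icc_self ht)
    have h2 : ‖f t‖ ≤ ‖f b‖ + ‖f t - f b‖ := norm_le_norm_add_norm_sub' _ _
    have h3 := add_sq_le (a := ‖f b‖) (b := ‖f t - f b‖)
    nlinarith [pow_le_pow_left₀ (norm_nonneg _) h2 2]
  have h := setIntegral_mono_on hf (integrableOn_const measure_Ioo_lt_top.ne) measurableSet_Ioo hpt
  rw [setIntegral_const, Real.volume_real_Ioo_of_le hbd, smul_eq_mul] at h
  exact h.trans_eq (by ring)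

theorem integral_sq_norm_le_sum (hfg : IsPrimitiveOn b d f g) (hbd : b ≤ d)
    (hg : MemLp g 2 (volume.restrict (Set.Ioo b d))) {m : ℕ} (hm : m ≠ 0) :
    ∫ t in Set.Ioo b d, ‖f t‖ ^ 2
      ≤ 2 * ((d - b) / m) * (∑ j ∈ Finset.range m, ‖f (b + j * ((d - b) / m))‖ ^ 2)
        + 2 * ((d - b) / m) ^ 2 * ∫ t in Set.Ioo b d, ‖g t‖ ^ 2 := by
  have hm' : (m : ℝ) ≠ 0 := Nat.cast_ne_zero.2 hm
  set l := (d - b) / m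
  have : 0 ≤ l := div_nonneg (sub_nonneg.2 hbd) m.cast_nonneg
  have hml : b + m * l = d := by rw [mul_div_cancel₀ _ hm', add_sub_cancel]
  let e : ℕ → ℝ := fun j => b + j * l
  have he : Monotone e := fun i j hij => by simp only [e]; gcongr
  have he0 : e 0 = b := by simp [e]
  have hem : e m = d := hml
  have hsucc : ∀ j, e (j + 1) - e j = l := fun j => by simp only [e]; push_cast; ring
  have hb : ∀ j, b ≤ e j := fun j => he0 ▸ he j.zero_le
  have hd : ∀ {j}, j ∈ Finset.range m → e (j + 1) ≤ d := fun hj =>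
    hem ▸ he (Finset.mem_range.1 hj)
  have hsplit : ∀ {u : ℝ → E}, MemLp u 2 (volume.restrict (Set.Ioo b d)) →
      ∫ t in Set.Ioo b d, ‖u t‖ ^ 2
        = ∑ j ∈ Finset.range m, ∫ t in Set.Ioo (e j) (e (j + 1)), ‖u t‖ ^ 2 := fun {u} hu => by
    have h := sum_setIntegral_Ioo he (m := m) (f := fun t => ‖u t‖ ^ 2)
    rw [he0, hem] at h
    exact (h (hu.integrable_norm_pow two_ne_zero)).symm
  rw [hsplit (hfg.memLp hbd (hg.integrable one_le_two)), hsplit hg, Finset.mul_sum, Finset.mul_sum,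
    ← Finset.sum_add_distrib]
  refine Finset.sum_le_sum fun j hj => ?_
  have h := (hfg.mono (hb j) (hd hj)).integral_sq_norm_le (he j.le_succ)
    (hg.mono_measure (Measure.restrict_mono_set _ (Set.Ioo_subset_Ioo (hb j) (hd hj))))
  rwa [hsucc] at h

theorem integral_add_sub_smul [CompleteSpace E] (hfg : IsPrimitiveOn b d f g) (hbd : b ≤ d)
    (hg : IntegrableOn g (Set.Ioo b d)) (c : ℝ) :
    ∫ t in Set.Ioo b d, (f t + (t - c) • g t) = (d - c) • f d - (b - c) • f b := by
  have hb : b ∈ Set.Icc b d := ⟨le_rfl, hbd⟩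
  have hderiv : deriv (fun t : ℝ => t - c) = fun _ => 1 := funext fun t => by simp
  have h := integral_deriv_smul_integral hbd hg (ρ := fun t => t - c) (by fun_prop)
  have hf : IntegrableOn f (Set.Ioo b d) :=
    ((hfg.continuousOn hbd hg).integrableOn_compact isCompact_Icc).mono_set Set.Ioo_subset_Icc_self
  rw [hderiv, ← hfg b hb d ⟨hbd, le_rfl⟩] at h
  simp only [one_smul, intervalIntegral.integral_of_le hbd, integral_Ioc_eq_integral_Ioo] at h
  rw [setIntegral_congr_fun measurableSet_Ioo fun t ht =>
    (hfg b hb t (Set.Ioo_subset_Icc_self ht)).symm, integral_sub hf (integrable_const _),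
    setIntegral_const, Real.volume_real_Ioo_of_le hbd, sub_eq_iff_eq_add] at h
  rw [integral_add hf (integrableOn_continuous_smul (by fun_prop) hg), h]
  module

end IsPrimitiveOn

end Primitive

/-! ### Fourier coefficients on horizontal slices -/

namespace GratingProblem

section Slices

variable (S : GratingProblem)

theorem restrict_cell : (volume.restrict S.cell : Measure (ℝ × ℝ))
    = (volume.restrict (Set.Ioo 0 S.p)).prod (volume.restrict (Set.Ioo S.b S.d)) := by
  rw [Measure.prod_restrict]
  rfl

/-- The function `exp(-i αₙ x)` against which the `n`-th Fourier coefficient is taken. -/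
def wave (n : ℤ) (x : ℝ) : ℂ := Complex.exp (-(Complex.I * S.α n * x))

theorem contDiff_wave (n : ℤ) : ContDiff ℝ ∞ (S.wave n) :=
  ((contDiff_const.mul Complex.ofRealCLM.contDiff).neg).cexp

theorem continuous_wave (n : ℤ) : Continuous (S.wave n) := (S.contDiff_wave n).continuous

theorem hasDerivAt_wave (n : ℤ) (x : ℝ) :
    HasDerivAt (S.wave n) (-(Complex.I * S.α n) * S.wave n x) x := by
  have h : HasDerivAt (fun x : ℝ => -(Complex.I * S.α n * x)) (-(Complex.I * S.α n)) x := by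
    have h1 := (Complex.ofRealCLM.hasDerivAt (x := x)).const_mul (Complex.I * S.α n)
    rw [Complex.ofRealCLM_apply, Complex.ofReal_one, mul_one] at h1
    exact h1.neg
  exact h.cexp.congr_deriv (mul_comm _ _)

theorem norm_wave (n : ℤ) (x : ℝ) : ‖S.wave n x‖ = 1 := by
  rw [wave, show -(Complex.I * S.α n * x) = ((-(S.α n * x) : ℝ) : ℂ) * Complex.I by
    push_cast; ring, Complex.norm_exp_ofReal_mul_I]

theorem wave_eq_wave_zero_mul_fourier (n : ℤ) (x : ℝ) :
    S.wave n x = S.wave 0 x * fourier (-n) (x : AddCircle S.p) := by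
  rw [fourier_coe_apply, wave, wave, ← Complex.exp_add, α, α]
  congr 1
  push_cast
  ring

theorem wave_add_p (n : ℤ) (x : ℝ) :
    S.wave n (x + S.p) = Complex.exp (-(Complex.I * S.αhat * S.p)) * S.wave n x := by
  rw [wave_eq_wave_zero_mul_fourier, wave_eq_wave_zero_mul_fourier S n x,
    AddCircle.coe_add_period, ← mul_assoc, wave, wave, ← Complex.exp_add, α]
  congr 2
  push_cast
  ring

theorem fourierCoefficient_eq_setIntegral (f : ℝ → ℂ) (n : ℤ) :
    S.fourierCoefficient f n = (S.p : ℂ)⁻¹ * ∫ x in Set.Ioo 0 S.p, f x * S.wave n x := by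
  rw [fourierCoefficient, intervalIntegral.integral_of_le S.p_pos.le,
    integral_Ioc_eq_integral_Ioo, one_div, Complex.ofReal_inv]
  rfl

theorem hasSum_sq_norm_fourierCoefficient {f : ℝ → ℂ}
    (hf : MemLp f 2 (volume.restrict (Set.Ioo 0 S.p))) :
    HasSum (fun n => ‖S.fourierCoefficient f n‖ ^ 2)
      (S.p⁻¹ * ∫ x in Set.Ioo 0 S.p, ‖f x‖ ^ 2) := by
  have hg : MemLp (fun x => S.wave 0 x * f x) 2 (volume.restrict (Set.Ioc 0 S.p)) := by
    rw [restrict_Ioo_eq_restrict_Ioc] at hf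
    refine hf.of_le ((S.continuous_wave 0).aestronglyMeasurable.mul hf.1) (ae_of_all _ fun x => ?_)
    rw [norm_mul, norm_wave, one_mul]
  have hcoeff : ∀ n,
      fourierCoeffOn S.p_pos (fun x => S.wave 0 x * f x) n = S.fourierCoefficient f n := by
    intro n
    rw [fourierCoeffOn_eq_integral, fourierCoefficient, sub_zero, Complex.real_smul]
    refine congrArg _ (intervalIntegral.integral_congr fun x _ => ?_)
    change fourier (-n) (x : AddCircle S.p) • (S.wave 0 x * f x) = f x * S.wave n x
    rw [wave_eq_wave_zero_mul_fourier S n, smul_eq_mul]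
    ring
  have h := hasSum_sq_fourierCoeffOn S.p_pos hg
  simp only [hcoeff, norm_mul, norm_wave, one_mul, sub_zero, smul_eq_mul,
    intervalIntegral.integral_of_le S.p_pos.le, integral_Ioc_eq_integral_Ioo] at h
  exact h

/-- The `n`-th Fourier coefficient of `f` along the horizontal line at height `t`. -/
def sliceCoeff (n : ℤ) (f : ℝ × ℝ → ℂ) (t : ℝ) : ℂ := S.fourierCoefficient (fun x => f (x, t)) n

variable {S} {f : ℝ × ℝ → ℂ}

theorem ae_hasSum_sq_norm_sliceCoeff (hf : MemLp f 2 (volume.restrict S.cell)) :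
    ∀ᵐ t ∂volume.restrict (Set.Ioo S.b S.d), HasSum (fun n => ‖S.sliceCoeff n f t‖ ^ 2)
      (S.p⁻¹ * ∫ x in Set.Ioo 0 S.p, ‖f (x, t)‖ ^ 2) := by
  have hm := hf.1
  have hi := hf.integrable_norm_pow two_ne_zero
  rw [restrict_cell] at hm hi
  filter_upwards [hm.prodMk_right, hi.prod_left_ae] with t hmt hit
  exact S.hasSum_sq_norm_fourierCoefficient ((memLp_two_iff_integrable_sq_norm hmt).2 hit)

theorem aestronglyMeasurable_sliceCoeff (hf : AEStronglyMeasurable f (volume.restrict S.cell))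
    (n : ℤ) : AEStronglyMeasurable (S.sliceCoeff n f) (volume.restrict (Set.Ioo S.b S.d)) := by
  rw [restrict_cell] at hf
  have h : AEStronglyMeasurable (fun t => ∫ x in Set.Ioo 0 S.p, f (x, t) * S.wave n x)
      (volume.restrict (Set.Ioo S.b S.d)) :=
    (hf.mul ((S.continuous_wave n).comp continuous_fst).aestronglyMeasurable).prod_swap
      |>.integral_prod_right'
  exact (h.const_mul _).congr (ae_of_all _ fun t =>
    (S.fourierCoefficient_eq_setIntegral (fun x => f (x, t)) n).symm)

theorem integrable_integral_sq_norm_slice (hf : MemLp f 2 (volume.restrict S.cell)) :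
    Integrable (fun t => ∫ x in Set.Ioo 0 S.p, ‖f (x, t)‖ ^ 2)
      (volume.restrict (Set.Ioo S.b S.d)) := by
  have hi := hf.integrable_norm_pow two_ne_zero
  rw [restrict_cell] at hi
  exact hi.integral_prod_right

theorem memLp_sliceCoeff (hf : MemLp f 2 (volume.restrict S.cell)) (n : ℤ) :
    MemLp (S.sliceCoeff n f) 2 (volume.restrict (Set.Ioo S.b S.d)) := by
  have hm := aestronglyMeasurable_sliceCoeff hf.1 n
  refine (memLp_two_iff_integrable_sq_norm hm).2
    (((integrable_integral_sq_norm_slice hf).const_mul S.p⁻¹).mono' (hm.norm.pow 2) ?_)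
  filter_upwards [ae_hasSum_sq_norm_sliceCoeff hf] with t ht
  rw [Real.norm_of_nonneg (sq_nonneg _)]
  exact le_hasSum ht n fun m _ => sq_nonneg _

theorem integrableOn_sliceCoeff (hf : MemLp f 2 (volume.restrict S.cell)) (n : ℤ) :
    IntegrableOn (S.sliceCoeff n f) (Set.Ioo S.b S.d) :=
  (memLp_sliceCoeff hf n).integrable one_le_two

theorem hasSum_integral_sq_norm_sliceCoeff (hf : MemLp f 2 (volume.restrict S.cell)) :
    HasSum (fun n => ∫ t in Set.Ioo S.b S.d, ‖S.sliceCoeff n f t‖ ^ 2)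
      (S.p⁻¹ * ∫ x in S.cell, ‖f x‖ ^ 2) := by
  have hae := ae_hasSum_sq_norm_sliceCoeff hf
  have hi := hf.integrable_norm_pow two_ne_zero
  rw [restrict_cell] at hi
  rw [restrict_cell, integral_prod_symm _ hi, ← integral_const_mul]
  refine hasSum_integral_of_dominated_convergence (fun n t => ‖S.sliceCoeff n f t‖ ^ 2)
    (fun n => (memLp_sliceCoeff hf n).1.norm.pow 2)
    (fun n => ae_of_all _ fun t => (Real.norm_of_nonneg (sq_nonneg _)).le)
    (hae.mono fun t ht => ht.summable) ?_ hae
  exact ((integrable_integral_sq_norm_slice hf).const_mul S.p⁻¹).congr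
    (hae.mono fun t ht => ht.tsum_eq.symm)

theorem setIntegral_cell_mul_wave {ρ : ℝ → ℝ} {n : ℤ}
    (h : Integrable (fun x => f x * (ρ x.2 * S.wave n x.1)) (volume.restrict S.cell)) :
    ∫ x in S.cell, f x * (ρ x.2 * S.wave n x.1)
      = S.p * ∫ t in Set.Ioo S.b S.d, ρ t • S.sliceCoeff n f t := by
  have hp : (S.p : ℂ) ≠ 0 := by exact_mod_cast S.p_pos.ne'
  rw [restrict_cell] at h ⊢
  rw [integral_prod_symm _ h, ← integral_const_mul]
  refine integral_congr_ae (ae_of_all _ fun t => ?_)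
  simp only [sliceCoeff, fourierCoefficient_eq_setIntegral, Complex.real_smul]
  rw [mul_left_comm, mul_inv_cancel_left₀ hp, ← integral_const_mul]
  exact integral_congr_ae (ae_of_all _ fun x => mul_left_comm _ _ _)

theorem setIntegral_cell_mul_continuous_mul_wave (f : S.L2) (n : ℤ) {ρ : ℝ → ℝ}
    (hρ : Continuous ρ) :
    ∫ x in S.cell, f x * (ρ x.2 * S.wave n x.1)
      = S.p * ∫ t in Set.Ioo S.b S.d, ρ t • S.sliceCoeff n f t :=
  setIntegral_cell_mul_wave (S.integrable_mul_continuous f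
    (.mul (by fun_prop) ((S.continuous_wave n).comp continuous_fst)))

end Slices

end GratingProblem

/-! ### Weak derivatives and traces of the Fourier modes -/

namespace GratingProblem

section TestFunctions

variable (S : GratingProblem) (n : ℤ) {ρ : ℝ → ℝ}

theorem isTestFunction_mul_wave (hρ : ContDiff ℝ ∞ ρ) (hc : HasCompactSupport ρ)
    (hsupp : tsupport ρ ⊆ Set.Ioo S.b S.d) :
    S.IsTestFunction fun x => (ρ x.2 : ℂ) * S.wave n x.1 := by
  obtain ⟨b', d', hb, hd, hsub⟩ := exists_Icc_superset_of_subset_Ioo hc.isCompact S.b_lt_d hsupp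
  refine ⟨?_, fun x₁ x₂ => ?_, b', d', hb, hd, fun x hx => ?_⟩
  · exact (Complex.ofRealCLM.contDiff.comp (hρ.comp contDiff_snd)).mul
      ((S.contDiff_wave n).comp contDiff_fst)
  · simp only [wave_add_p, mul_left_comm]
  · simp only [image_eq_zero_of_notMem_tsupport fun h => hx (hsub h), Complex.ofReal_zero, zero_mul]

theorem fderiv_mul_wave (hρ : Differentiable ℝ ρ) (x e : ℝ × ℝ) :
    fderiv ℝ (fun x : ℝ × ℝ => (ρ x.2 : ℂ) * S.wave n x.1) x e
      = ((e.2 * deriv ρ x.2 : ℝ) : ℂ) * S.wave n x.1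
        + e.1 * (-(Complex.I * S.α n) * (ρ x.2 * S.wave n x.1)) := by
  have h1 : HasFDerivAt (fun x : ℝ × ℝ => (ρ x.2 : ℂ)) _ x :=
    ((hρ x.2).hasDerivAt.ofReal_comp).hasFDerivAt.comp x hasFDerivAt_snd
  have h2 : HasFDerivAt (fun x : ℝ × ℝ => S.wave n x.1) _ x :=
    (S.hasDerivAt_wave n x.1).hasFDerivAt.comp x hasFDerivAt_fst
  refine (congrArg (fun A : ℝ × ℝ →L[ℝ] ℂ => A e) (h1.mul h2).fderiv).trans ?_
  simp
  ring

end TestFunctions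

section InnerProduct

variable {S : GratingProblem}

theorem integrable_mul_conj (f g : S.L2) :
    Integrable (fun x => f x * conj (g x)) (volume.restrict S.cell) := by
  refine (L2.integrable_inner (𝕜 := ℂ) g f).congr (ae_of_all _ fun x => ?_)
  simp only [RCLike.inner_apply]

theorem inner_eq_integral (f g : S.L2) : inner ℂ g f = ∫ x in S.cell, f x * conj (g x) := by
  rw [L2.inner_def]
  refine integral_congr_ae (ae_of_all _ fun x => ?_)
  simp only [RCLike.inner_apply]

end InnerProduct

section Modes

variable {S : GratingProblem} (u : S.H1) (n : ℤ)

theorem memLp_val : MemLp (val u) 2 (volume.restrict S.cell) := Lp.memLp _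

theorem memLp_d₁ : MemLp (d₁ u) 2 (volume.restrict S.cell) := Lp.memLp _

theorem memLp_d₂ : MemLp (d₂ u) 2 (volume.restrict S.cell) := Lp.memLp _

theorem isWeakDerivOn_sliceCoeff :
    IsWeakDerivOn S.b S.d (S.sliceCoeff n (val u)) (S.sliceCoeff n (d₂ u)) := by
  intro ρ hρ hc hsupp
  have hp : (S.p : ℂ) ≠ 0 := by exact_mod_cast S.p_pos.ne'
  have h := u.2.2 _ (S.isTestFunction_mul_wave n hρ hc hsupp)
  simp only [S.fderiv_mul_wave n (hρ.differentiable (by simp)), one_mul, Complex.ofReal_zero,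
    zero_mul, add_zero] at h
  rw [setIntegral_cell_mul_continuous_mul_wave _ _ (hρ.continuous_deriv (by simp)),
    setIntegral_cell_mul_continuous_mul_wave _ _ hρ.continuous, ← mul_neg] at h
  exact mul_left_cancel₀ hp h

theorem sliceCoeff_d₁_ae_eq : ∀ᵐ t ∂volume.restrict (Set.Ioo S.b S.d),
    S.sliceCoeff n (d₁ u) t = Complex.I * S.α n * S.sliceCoeff n (val u) t := by
  have hp : (S.p : ℂ) ≠ 0 := by exact_mod_cast S.p_pos.ne'
  have hval := integrableOn_sliceCoeff (memLp_val u) n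
  have hd₁ := integrableOn_sliceCoeff (memLp_d₁ u) n
  have hint := hd₁.sub (hval.const_mul (Complex.I * S.α n))
  have horth : ∀ ρ : ℝ → ℝ, ContDiff ℝ ∞ ρ → HasCompactSupport ρ → tsupport ρ ⊆ Set.Ioo S.b S.d →
      ∫ t in Set.Ioo S.b S.d,
        ρ t • (S.sliceCoeff n (d₁ u) t - Complex.I * S.α n * S.sliceCoeff n (val u) t) = 0 := by
    intro ρ hρ hc hsupp
    have h := u.2.1 _ (S.isTestFunction_mul_wave n hρ hc hsupp)
    simp only [S.fderiv_mul_wave n (hρ.differentiable (by simp)), zero_mul, Complex.ofReal_zero,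
      zero_add, Complex.ofReal_one, one_mul, mul_left_comm _ (-(Complex.I * S.α n)),
      integral_const_mul] at h
    rw [setIntegral_cell_mul_continuous_mul_wave _ _ hρ.continuous,
      setIntegral_cell_mul_continuous_mul_wave _ _ hρ.continuous] at h
    simp only [smul_sub, ← mul_smul_comm]
    rw [integral_sub (integrableOn_continuous_smul hρ.continuous hd₁)
      ((integrableOn_continuous_smul hρ.continuous hval).const_mul _), integral_const_mul]
    refine mul_left_cancel₀ hp ?_
    unfold val d₁
    linear_combination h
  have h := isOpen_Ioo.ae_eq_zero_of_integral_contDiff_smul_eq_zero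
    (IntegrableOn.locallyIntegrableOn hint) fun ρ hρ hc hsupp => by
      rw [← horth ρ hρ hc hsupp, setIntegral_eq_integral_of_forall_compl_eq_zero fun t ht => by
        rw [image_eq_zero_of_notMem_tsupport fun h => ht (hsupp h), zero_smul]]
      rfl
  filter_upwards [(ae_restrict_iff' measurableSet_Ioo).2 h] with t ht using sub_eq_zero.1 ht

/-- The height dependence of the `n`-th Fourier mode of `u`: the absolutely continuous
representative of `t ↦ sliceCoeff n u t`, normalized by its trace at `b`. -/
def modeCoeff (t : ℝ) : ℂ := bottomCoeff u n + ∫ s in S.b..t, S.sliceCoeff n (d₂ u) s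

theorem isPrimitiveOn_modeCoeff :
    IsPrimitiveOn S.b S.d (modeCoeff u n) (S.sliceCoeff n (d₂ u)) :=
  isPrimitiveOn_const_add_integral (integrableOn_sliceCoeff (memLp_d₂ u) n) _

theorem fourierCoefficient_trace (c : ℝ) :
    S.fourierCoefficient (fun x₁ => ((S.d - S.b : ℝ) : ℂ)⁻¹ *
        ∫ t in S.b..S.d, (val u (x₁, t) + ((t - c : ℝ) : ℂ) * d₂ u (x₁, t))) n
      = (S.p : ℂ)⁻¹ * (((S.d - S.b : ℝ) : ℂ)⁻¹ * ((∫ x in S.cell, val u x * S.wave n x.1)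
        + ∫ x in S.cell, d₂ u x * (((x.2 - c : ℝ) : ℂ) * S.wave n x.1))) := by
  have hw : Continuous fun x : ℝ × ℝ => S.wave n x.1 := (S.continuous_wave n).comp continuous_fst
  have hval : Integrable (fun x => val u x * S.wave n x.1) (volume.restrict S.cell) :=
    S.integrable_mul_continuous _ hw
  have hd₂ : Integrable (fun x => d₂ u x * (((x.2 - c : ℝ) : ℂ) * S.wave n x.1))
    (volume.restrict S.cell) := S.integrable_mul_continuous _ (.mul (by fun_prop) hw)
  have h : Integrable (fun x => val u x * S.wave n x.1
      + d₂ u x * (((x.2 - c : ℝ) : ℂ) * S.wave n x.1)) (volume.restrict S.cell) := hval.add hd₂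
  rw [← integral_add hval hd₂, fourierCoefficient_eq_setIntegral]
  rw [restrict_cell] at h ⊢
  rw [integral_prod _ h, ← integral_const_mul (((S.d - S.b : ℝ) : ℂ)⁻¹)]
  refine congrArg _ (integral_congr_ae (ae_of_all _ fun x => ?_))
  simp only
  rw [mul_assoc, intervalIntegral.integral_of_le S.b_lt_d.le, integral_Ioc_eq_integral_Ioo,
    ← integral_mul_const]
  refine congrArg _ (integral_congr_ae (ae_of_all _ fun t => ?_))
  ring

theorem fourierCoefficient_trace_eq_integral_sliceCoeff (c : ℝ) :
    S.fourierCoefficient (fun x₁ => ((S.d - S.b : ℝ) : ℂ)⁻¹ *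
        ∫ t in S.b..S.d, (val u (x₁, t) + ((t - c : ℝ) : ℂ) * d₂ u (x₁, t))) n
      = (S.d - S.b)⁻¹ • ∫ t in Set.Ioo S.b S.d,
        (S.sliceCoeff n (val u) t + (t - c) • S.sliceCoeff n (d₂ u) t) := by
  have hp : (S.p : ℂ) ≠ 0 := by exact_mod_cast S.p_pos.ne'
  have hval : ∫ x in S.cell, val u x * S.wave n x.1
      = S.p * ∫ t in Set.Ioo S.b S.d, S.sliceCoeff n (val u) t := by
    have h := setIntegral_cell_mul_continuous_mul_wave (u.1 0) n (continuous_const (y := (1 : ℝ)))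
    simp only [Complex.ofReal_one, one_mul, one_smul] at h
    exact h
  have hd₂ : ∫ x in S.cell, d₂ u x * (((x.2 - c : ℝ) : ℂ) * S.wave n x.1)
      = S.p * ∫ t in Set.Ioo S.b S.d, (t - c) • S.sliceCoeff n (d₂ u) t :=
    setIntegral_cell_mul_continuous_mul_wave (u.1 2) n (continuous_id.sub continuous_const)
  rw [fourierCoefficient_trace, hval, hd₂, ← mul_add, mul_left_comm, inv_mul_cancel_left₀ hp,
    ← integral_add (integrableOn_sliceCoeff (memLp_val u) n)
      (integrableOn_continuous_smul (by fun_prop) (integrableOn_sliceCoeff (memLp_d₂ u) n)),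
    Complex.real_smul, Complex.ofReal_inv]

theorem modeCoeff_b : modeCoeff u n S.b = bottomCoeff u n := by
  rw [modeCoeff, intervalIntegral.integral_same, add_zero]

theorem sliceCoeff_val_ae_eq : S.sliceCoeff n (val u)
    =ᵐ[volume.restrict (Set.Ioo S.b S.d)] modeCoeff u n := by
  have hd₂ := integrableOn_sliceCoeff (memLp_d₂ u) n
  obtain ⟨c, hc⟩ := (isWeakDerivOn_sliceCoeff u n).exists_ae_eq_add_integral S.b_lt_d
    (integrableOn_sliceCoeff (memLp_val u) n) hd₂
  have hcb : bottomCoeff u n = c := by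
    have hbd : S.d - S.b ≠ 0 := (sub_pos.2 S.b_lt_d).ne'
    refine (fourierCoefficient_trace_eq_integral_sliceCoeff u n S.d).trans ?_
    rw [integral_congr_ae (hc.mono fun t ht => congrArg (· + _) ht),
      (isPrimitiveOn_const_add_integral hd₂ c).integral_add_sub_smul S.b_lt_d.le hd₂,
      intervalIntegral.integral_same, sub_self, zero_smul, zero_sub, add_zero, ← neg_smul,
      neg_sub, inv_smul_smul₀ hbd]
  filter_upwards [hc] with t ht
  rw [ht, modeCoeff, hcb]

theorem modeCoeff_d : modeCoeff u n S.d = topCoeff u n := by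
  have hbd : S.d - S.b ≠ 0 := (sub_pos.2 S.b_lt_d).ne'
  refine ((fourierCoefficient_trace_eq_integral_sliceCoeff u n S.b).trans ?_).symm
  rw [integral_congr_ae ((sliceCoeff_val_ae_eq u n).mono fun t ht => congrArg (· + _) ht),
    (isPrimitiveOn_modeCoeff u n).integral_add_sub_smul S.b_lt_d.le
      (integrableOn_sliceCoeff (memLp_d₂ u) n), sub_self, zero_smul, sub_zero, inv_smul_smul₀ hbd]

/-- The contribution of the `n`-th Fourier mode to `p⁻¹ ‖u‖²`. -/
def modeEnergy : ℝ := (1 + S.α n ^ 2) * (∫ t in Set.Ioo S.b S.d, ‖modeCoeff u n t‖ ^ 2)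
  + ∫ t in Set.Ioo S.b S.d, ‖S.sliceCoeff n (d₂ u) t‖ ^ 2

theorem hasSum_integral_sq_norm_modeCoeff :
    HasSum (fun n => ∫ t in Set.Ioo S.b S.d, ‖modeCoeff u n t‖ ^ 2)
      (S.p⁻¹ * ∫ x in S.cell, ‖val u x‖ ^ 2) := by
  convert hasSum_integral_sq_norm_sliceCoeff (memLp_val u) using 2 with n
  exact integral_congr_ae ((sliceCoeff_val_ae_eq u n).mono fun t ht => by simp only [ht])

theorem integral_sq_norm_sliceCoeff_d₁ :
    ∫ t in Set.Ioo S.b S.d, ‖S.sliceCoeff n (d₁ u) t‖ ^ 2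
      = S.α n ^ 2 * ∫ t in Set.Ioo S.b S.d, ‖modeCoeff u n t‖ ^ 2 := by
  rw [← integral_const_mul]
  refine integral_congr_ae ?_
  filter_upwards [sliceCoeff_d₁_ae_eq u n, sliceCoeff_val_ae_eq u n] with t h1 h2
  rw [h1, h2, norm_mul, norm_mul, Complex.norm_I, one_mul, mul_pow, Complex.norm_real,
    Real.norm_eq_abs, sq_abs]

theorem integral_sq_norm_eq_sq_norm (f : S.L2) : ∫ x in S.cell, ‖f x‖ ^ 2 = ‖f‖ ^ 2 := by
  have h : ((‖f‖ ^ 2 : ℝ) : ℂ) = ((∫ x in S.cell, ‖f x‖ ^ 2 : ℝ) : ℂ) := by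
    rw [Complex.ofReal_pow, ← integral_complex_ofReal]
    refine (inner_self_eq_norm_sq_to_K f).symm.trans ((inner_eq_integral f f).trans ?_)
    simp only [Complex.mul_conj, Complex.normSq_eq_norm_sq]
  exact_mod_cast h.symm

theorem sq_norm_eq : ‖u‖ ^ 2 = (∫ x in S.cell, ‖val u x‖ ^ 2) + (∫ x in S.cell, ‖d₁ u x‖ ^ 2)
    + ∫ x in S.cell, ‖d₂ u x‖ ^ 2 := by
  change ‖u.1‖ ^ 2 = _
  rw [PiLp.norm_sq_eq_of_L2, Fin.sum_univ_three, val, d₁, d₂, integral_sq_norm_eq_sq_norm,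
    integral_sq_norm_eq_sq_norm, integral_sq_norm_eq_sq_norm]

theorem hasSum_modeEnergy : HasSum (modeEnergy u) (S.p⁻¹ * ‖u‖ ^ 2) := by
  have h := ((hasSum_integral_sq_norm_modeCoeff u).add
    (hasSum_integral_sq_norm_sliceCoeff (memLp_d₁ u))).add
    (hasSum_integral_sq_norm_sliceCoeff (memLp_d₂ u))
  rw [← mul_add, ← mul_add, ← sq_norm_eq] at h
  convert h using 2 with n
  rw [modeEnergy, integral_sq_norm_sliceCoeff_d₁]
  ring

theorem modeEnergy_nonneg : 0 ≤ modeEnergy u n := by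
  unfold modeEnergy
  positivity

theorem sum_modeEnergy_le (s : Finset ℤ) : ∑ n ∈ s, modeEnergy u n ≤ S.p⁻¹ * ‖u‖ ^ 2 :=
  sum_le_hasSum s (fun n _ => modeEnergy_nonneg u n) (hasSum_modeEnergy u)

/-- The pointwise bound of `length_mul_mul_sq_norm_le` at the wavelength scale `1 + |αₙ|`. -/
theorem length_mul_mul_sq_norm_modeCoeff_le {e : ℝ} (he : e ∈ Set.Icc S.b S.d) :
    (S.d - S.b) * ((1 + |S.α n|) * ‖modeCoeff u n e‖ ^ 2)
      ≤ (4 + 2 * (S.d - S.b) ^ 2) * modeEnergy u n := by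
  have h := (isPrimitiveOn_modeCoeff u n).length_mul_mul_sq_norm_le
    (memLp_sliceCoeff (memLp_d₂ u) n) he (l := 1 + |S.α n|) (by simp)
  have hsq : (1 + |S.α n|) ^ 2 ≤ 2 * (1 + S.α n ^ 2) := by
    nlinarith [sq_nonneg (1 - |S.α n|), sq_abs (S.α n)]
  have hF : 0 ≤ ∫ t in Set.Ioo S.b S.d, ‖modeCoeff u n t‖ ^ 2 := by positivity
  have hG : 0 ≤ ∫ t in Set.Ioo S.b S.d, ‖S.sliceCoeff n (d₂ u) t‖ ^ 2 := by positivity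
  refine h.trans ?_
  rw [modeEnergy]
  nlinarith [mul_le_mul_of_nonneg_right hsq hF, mul_nonneg (sq_nonneg (S.d - S.b))
    (mul_nonneg (by positivity : 0 ≤ 1 + S.α n ^ 2) hF)]

theorem exists_sum_mul_sq_norm_modeCoeff_le (S : GratingProblem) : ∃ K : ℝ, ∀ e ∈ Set.Icc S.b S.d,
    ∀ (u : S.H1) (s : Finset ℤ), ∑ n ∈ s, (1 + |S.α n|) * ‖modeCoeff u n e‖ ^ 2
      ≤ K * ‖u‖ ^ 2 := by
  have hbd : 0 < S.d - S.b := sub_pos.2 S.b_lt_d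
  refine ⟨(S.d - S.b)⁻¹ * ((4 + 2 * (S.d - S.b) ^ 2) * S.p⁻¹), fun e he u s => ?_⟩
  rw [mul_assoc, le_inv_mul_iff₀ hbd, Finset.mul_sum, mul_assoc]
  calc ∑ n ∈ s, (S.d - S.b) * ((1 + |S.α n|) * ‖modeCoeff u n e‖ ^ 2)
      ≤ ∑ n ∈ s, (4 + 2 * (S.d - S.b) ^ 2) * modeEnergy u n :=
        Finset.sum_le_sum fun n _ => length_mul_mul_sq_norm_modeCoeff_le u n he
    _ ≤ (4 + 2 * (S.d - S.b) ^ 2) * (S.p⁻¹ * ‖u‖ ^ 2) := by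
        rw [← Finset.mul_sum]
        gcongr
        exact sum_modeEnergy_le u s

end Modes

end GratingProblem

/-! ### The compact embedding of `H¹` into `L²` -/

section CompactOperator

variable {𝕜 H : Type*} [RCLike 𝕜] [SeminormedAddCommGroup H] [NormedSpace 𝕜 H]

theorem isCompactOperator_smulRight {E : Type*} [SeminormedAddCommGroup E] [NormedSpace 𝕜 E]
    (φ : H →L[𝕜] 𝕜) (y : E) : IsCompactOperator (φ.smulRight y) :=
  (isCompactOperator_of_locallyCompactSpace_dom φ).clm_comp (.toSpanSingleton 𝕜 y)

/-- The functionals map the unit ball onto a totally bounded set, and `A` varies little where they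
do. -/
theorem isCompactOperator_of_forall_exists_sq_norm_le {E : Type*} [NormedAddCommGroup E]
    [NormedSpace 𝕜 E] [CompleteSpace E] (A : H →L[𝕜] E)
    (h : ∀ ε : ℝ, 0 < ε → ∃ (ι : Type) (_ : Fintype ι) (φ : ι → H →L[𝕜] 𝕜) (C : ℝ), ∀ u,
      ‖A u‖ ^ 2 ≤ ε * ‖u‖ ^ 2 + C * ∑ i, ‖φ i u‖ ^ 2) :
    IsCompactOperator A := by
  suffices hA : TotallyBounded (A '' Metric.closedBall 0 1) from
    (isCompactOperator_iff_isCompact_closure_image_closedBall (A : H →ₗ[𝕜] E) one_pos).2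
      (hA.closure.isCompact_of_isClosed isClosed_closure)
  refine Metric.totallyBounded_iff.2 fun ε hε => ?_
  obtain ⟨ι, _, φ, C, hφ⟩ := h (ε ^ 2 / 8) (by positivity)
  let Φ : H →L[𝕜] ι → 𝕜 := .pi φ
  have hcont : Continuous fun z : ι → 𝕜 => C * ∑ i, ‖z i‖ ^ 2 := by fun_prop
  obtain ⟨δ, hδ, hsmall⟩ := Metric.continuous_iff.1 hcont 0 (ε ^ 2 / 2) (by positivity)
  have hbdd : Bornology.IsBounded (Φ '' Metric.closedBall 0 1) :=
    Φ.lipschitz.isBounded_image Metric.isBounded_closedBall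
  have hΦ : TotallyBounded (Φ '' Metric.closedBall 0 1) :=
    hbdd.isCompact_closure.totallyBounded.subset subset_closure
  obtain ⟨t, htΦ, ht, hcover⟩ := Metric.finite_approx_of_totallyBounded hΦ δ hδ
  obtain ⟨s, hs, hsfin, rfl⟩ := Set.exists_subset_image_finite_and.1 ⟨t, htΦ, ht, rfl⟩
  refine ⟨A '' s, hsfin.image A, Set.image_subset_iff.2 fun u hu => ?_⟩
  obtain ⟨v, hv, huv⟩ : ∃ v ∈ s, dist (Φ u) (Φ v) < δ := by
    simpa only [Set.biUnion_image, Set.mem_iUnion₂, Metric.mem_ball, exists_prop]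
      using hcover (Set.mem_image_of_mem Φ hu)
  have hnorm : ‖u - v‖ ≤ 2 := by
    have hu1 := mem_closedBall_zero_iff.1 hu
    have hv1 := mem_closedBall_zero_iff.1 (hs hv)
    linarith [norm_sub_le u v]
  have hC : C * ∑ i, ‖φ i (u - v)‖ ^ 2 < ε ^ 2 / 2 := by
    rw [dist_eq_norm, ← map_sub, ← dist_zero_right] at huv
    have h := (le_abs_self _).trans_lt (hsmall _ huv)
    simpa [Φ] using h
  have hA : dist (A u) (A v) < ε := by
    rw [dist_eq_norm, ← map_sub]
    refine lt_of_pow_lt_pow_left₀ 2 hε.le ?_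
    nlinarith [hφ (u - v), pow_le_pow_left₀ (norm_nonneg _) hnorm 2, pow_pos hε 2]
  exact Set.mem_biUnion (Set.mem_image_of_mem A hv) hA

end CompactOperator

theorem exists_clm_eq_integral_mul {X 𝕜 : Type*} [MeasurableSpace X] [RCLike 𝕜] {μ : Measure X}
    {ψ : X → 𝕜} (hψ : MemLp ψ 2 μ) :
    ∃ Φ : Lp 𝕜 2 μ →L[𝕜] 𝕜, ∀ f, Φ f = ∫ x, f x * ψ x ∂μ := by
  refine ⟨innerSL 𝕜 hψ.star.toLp, fun f => ?_⟩
  rw [innerSL_apply_apply, L2.inner_def]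
  refine integral_congr_ae ?_
  filter_upwards [hψ.star.coeFn_toLp] with x hx
  rw [hx, RCLike.inner_apply, Pi.star_apply, RCLike.star_def, RCLike.conj_conj]

namespace GratingProblem

variable {S : GratingProblem}

theorem memLp_mul_wave_of_bounded (n : ℤ) {ρ : ℝ → ℝ} (hρ : Measurable ρ) {M : ℝ}
    (hM : ∀ t ∈ Set.Ioo S.b S.d, ‖ρ t‖ ≤ M) :
    MemLp (fun x => (ρ x.2 : ℂ) * S.wave n x.1) 2 (volume.restrict S.cell) := by
  have := S.cell_finite
  have hmeas : Measurable fun x : ℝ × ℝ => (ρ x.2 : ℂ) * S.wave n x.1 :=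
    (Complex.measurable_ofReal.comp (hρ.comp measurable_snd)).mul
      ((S.continuous_wave n).measurable.comp measurable_fst)
  refine .of_bound hmeas.aestronglyMeasurable M
    (ae_restrict_of_forall_mem (measurableSet_Ioo.prod measurableSet_Ioo) fun x hx => ?_)
  rw [norm_mul, Complex.norm_real, norm_wave, mul_one]
  exact hM x.2 hx.2

variable (S) in
/-- The maps `u ↦ u`, `u ↦ ∂₁u` and `u ↦ ∂₂u` from `H¹` to `L²`, for `i = 0, 1, 2`. -/
def componentCLM (i : Fin 3) : S.H1 →L[ℂ] S.L2 :=
  (PiLp.proj 2 (fun _ : Fin 3 => S.L2) i).comp S.H1.subtypeL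

theorem exists_bottomCoeff_clm (n : ℤ) : ∃ Φ : S.H1 →L[ℂ] ℂ, ∀ u, Φ u = bottomCoeff u n := by
  have hwave := memLp_mul_wave_of_bounded (S := S) n (ρ := 1) measurable_const (M := 1) (by simp)
  have hlin := memLp_mul_wave_of_bounded (S := S) n (ρ := fun t => t - S.d) (by fun_prop)
    (M := S.d - S.b) fun t ht => by
      rw [Real.norm_eq_abs, abs_le]
      constructor <;> linarith [ht.1, ht.2]
  obtain ⟨Φ₀, hΦ₀⟩ := exists_clm_eq_integral_mul hwave
  obtain ⟨Φ₂, hΦ₂⟩ := exists_clm_eq_integral_mul hlin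
  refine ⟨(S.p : ℂ)⁻¹ • ((S.d - S.b : ℝ) : ℂ)⁻¹ •
    (Φ₀.comp (S.componentCLM 0) + Φ₂.comp (S.componentCLM 2)), fun u =>
      Eq.trans ?_ (fourierCoefficient_trace u n S.d).symm⟩
  change (S.p : ℂ)⁻¹ * (((S.d - S.b : ℝ) : ℂ)⁻¹ * (Φ₀ (u.1 0) + Φ₂ (u.1 2))) = _
  simp only [hΦ₀, hΦ₂, Pi.one_apply, Complex.ofReal_one, one_mul]
  rfl

theorem exists_integral_sliceCoeff_clm (n : ℤ) {e : ℝ} (he : e ∈ Set.Icc S.b S.d) :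
    ∃ Φ : S.H1 →L[ℂ] ℂ, ∀ u, Φ u = ∫ s in S.b..e, S.sliceCoeff n (d₂ u) s := by
  have hind := memLp_mul_wave_of_bounded (S := S) n (ρ := (Set.Iio e).indicator 1)
    (measurable_one.indicator measurableSet_Iio) (M := 1) fun t _ =>
      (norm_indicator_le_norm_self 1 t).trans (by simp)
  obtain ⟨Φ, hΦ⟩ := exists_clm_eq_integral_mul hind
  refine ⟨(S.p : ℂ)⁻¹ • Φ.comp (S.componentCLM 2), fun u => ?_⟩
  have hp : (S.p : ℂ) ≠ 0 := by exact_mod_cast S.p_pos.ne'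
  change (S.p : ℂ)⁻¹ * Φ (u.1 2) = _
  rw [hΦ, setIntegral_cell_mul_wave ((Lp.memLp (u.1 2)).integrable_mul hind),
    inv_mul_cancel_left₀ hp, intervalIntegral.integral_of_le he.1, integral_Ioc_eq_integral_Ioo,
    ← min_eq_right he.2, ← Set.Ioo_inter_Iio, ← setIntegral_indicator measurableSet_Iio,
    min_eq_right he.2]
  refine integral_congr_ae (ae_of_all _ fun t => ?_)
  simp only [← Set.indicator_smul_apply_left, Pi.one_apply, one_smul]
  rfl

theorem exists_modeCoeff_clm (n : ℤ) {e : ℝ} (he : e ∈ Set.Icc S.b S.d) :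
    ∃ Φ : S.H1 →L[ℂ] ℂ, ∀ u, Φ u = modeCoeff u n e := by
  obtain ⟨Φ, hΦ⟩ := exists_bottomCoeff_clm (S := S) n
  obtain ⟨Ψ, hΨ⟩ := exists_integral_sliceCoeff_clm n he
  exact ⟨Φ + Ψ, fun u => by rw [add_apply, hΦ, hΨ, modeCoeff]⟩

theorem add_mul_div_mem_Icc {m j : ℕ} (hj : j < m) :
    S.b + j * ((S.d - S.b) / m) ∈ Set.Icc S.b S.d := by
  have hbd : 0 < S.d - S.b := sub_pos.2 S.b_lt_d
  have hm : (0 : ℝ) < m := by exact_mod_cast j.zero_le.trans_lt hj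
  have hjm : (j : ℝ) / m ≤ 1 := (div_le_one hm).2 (by exact_mod_cast hj.le)
  constructor
  · have : 0 ≤ j * ((S.d - S.b) / m) := by positivity
    linarith
  · have : j * ((S.d - S.b) / m) = j / m * (S.d - S.b) := by ring
    nlinarith

theorem integral_sq_norm_modeCoeff_le_of_le (u : S.H1) {n : ℤ} {ε : ℝ} (hε : 0 < ε)
    (hn : ε⁻¹ ≤ |S.α n|) :
    ∫ t in Set.Ioo S.b S.d, ‖modeCoeff u n t‖ ^ 2 ≤ ε * modeEnergy u n := by
  have hF : 0 ≤ ∫ t in Set.Ioo S.b S.d, ‖modeCoeff u n t‖ ^ 2 := by positivity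
  have hG : 0 ≤ ∫ t in Set.Ioo S.b S.d, ‖S.sliceCoeff n (d₂ u) t‖ ^ 2 := by positivity
  have hα : ε⁻¹ ≤ 1 + S.α n ^ 2 := by nlinarith [sq_abs (S.α n), sq_nonneg (1 - |S.α n|)]
  rw [← inv_mul_le_iff₀ hε, modeEnergy]
  nlinarith [mul_le_mul_of_nonneg_right hα hF]

theorem integral_sq_norm_modeCoeff_le_add_sum (u : S.H1) (n : ℤ) {ε : ℝ} {m : ℕ} (hm : m ≠ 0)
    (h : 2 * ((S.d - S.b) / m) ^ 2 ≤ ε) :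
    ∫ t in Set.Ioo S.b S.d, ‖modeCoeff u n t‖ ^ 2 ≤ ε * modeEnergy u n
      + 2 * ((S.d - S.b) / m)
        * ∑ j ∈ Finset.range m, ‖modeCoeff u n (S.b + j * ((S.d - S.b) / m))‖ ^ 2 := by
  have hG : 0 ≤ ∫ t in Set.Ioo S.b S.d, ‖S.sliceCoeff n (d₂ u) t‖ ^ 2 := by positivity
  have hbound := (isPrimitiveOn_modeCoeff u n).integral_sq_norm_le_sum S.b_lt_d.le
    (memLp_sliceCoeff (memLp_d₂ u) n) hm
  have hα : 0 ≤ (1 + S.α n ^ 2) * ∫ t in Set.Ioo S.b S.d, ‖modeCoeff u n t‖ ^ 2 := by positivity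
  rw [modeEnergy]
  nlinarith [mul_le_mul_of_nonneg_right h hG,
    mul_nonneg ((by positivity : (0 : ℝ) ≤ 2 * ((S.d - S.b) / m) ^ 2).trans h) hα]

/-- Modes with large `|αₙ|` are small in `L²` compared with their energy; the others are determined,
up to a small error, by their values on a fine grid. -/
theorem exists_sq_norm_componentCLM_zero_le (S : GratingProblem) {ε : ℝ} (hε : 0 < ε) :
    ∃ (N m : ℕ) (C : ℝ), ∀ u : S.H1, ‖S.componentCLM 0 u‖ ^ 2 ≤ ε * ‖u‖ ^ 2
      + C * ∑ n ∈ Finset.Icc (-N : ℤ) N,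
        ∑ j ∈ Finset.range m, ‖modeCoeff u n (S.b + j * ((S.d - S.b) / m))‖ ^ 2 := by
  have hp := S.p_pos
  obtain ⟨N, hN⟩ := S.exists_le_abs_α ε⁻¹
  have hlim : Tendsto (fun m : ℕ => 2 * ((S.d - S.b) / m) ^ 2) atTop (nhds 0) := by
    simpa using ((tendsto_const_div_atTop_nhds_zero_nat (S.d - S.b)).pow 2).const_mul 2
  obtain ⟨m, hm, hmε⟩ :=
    ((eventually_ne_atTop 0).and (hlim.eventually (eventually_le_nhds hε))).exists
  refine ⟨N, m, S.p * (2 * ((S.d - S.b) / m)), fun u => ?_⟩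
  set R : ℤ → ℝ := fun n =>
    ∑ j ∈ Finset.range m, ‖modeCoeff u n (S.b + j * ((S.d - S.b) / m))‖ ^ 2
  set F := Finset.Icc (-N : ℤ) N with hF
  have hmode : ∀ n, ∫ t in Set.Ioo S.b S.d, ‖modeCoeff u n t‖ ^ 2
      ≤ ε * modeEnergy u n + if n ∈ F then 2 * ((S.d - S.b) / m) * R n else 0 := by
    intro n
    split_ifs with hn
    · exact integral_sq_norm_modeCoeff_le_add_sum u n hm hmε
    · rw [hF, Finset.mem_Icc, ← abs_le, not_le] at hn
      exact (integral_sq_norm_modeCoeff_le_of_le u hε (hN n hn)).trans_eq (add_zero _).symm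
  have hlow : HasSum (fun n => if n ∈ F then 2 * ((S.d - S.b) / m) * R n else 0)
      (2 * ((S.d - S.b) / m) * ∑ n ∈ F, R n) := by
    have h := hasSum_sum_of_ne_finset_zero (s := F) (L := .unconditional ℤ)
      (f := fun n => if n ∈ F then 2 * ((S.d - S.b) / m) * R n else 0) fun n hn => if_neg hn
    rwa [Finset.sum_congr rfl fun n hn => if_pos hn, ← Finset.mul_sum] at h
  have hsum := hasSum_le hmode (hasSum_integral_sq_norm_modeCoeff u)
    (((hasSum_modeEnergy u).mul_left ε).add hlow)
  rw [inv_mul_le_iff₀ hp] at hsum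
  calc ‖S.componentCLM 0 u‖ ^ 2 = ∫ x in S.cell, ‖val u x‖ ^ 2 :=
        (integral_sq_norm_eq_sq_norm _).symm
    _ ≤ S.p * (ε * (S.p⁻¹ * ‖u‖ ^ 2) + 2 * ((S.d - S.b) / m) * ∑ n ∈ F, R n) := hsum
    _ = ε * ‖u‖ ^ 2 + S.p * (2 * ((S.d - S.b) / m)) * ∑ n ∈ F, R n := by field_simp

theorem isCompactOperator_componentCLM_zero (S : GratingProblem) :
    IsCompactOperator (S.componentCLM 0) := by
  refine isCompactOperator_of_forall_exists_sq_norm_le _ fun ε hε => ?_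
  obtain ⟨N, m, C, h⟩ := S.exists_sq_norm_componentCLM_zero_le hε
  choose φ hφ using fun i : Finset.Icc (-N : ℤ) N × Fin m =>
    exists_modeCoeff_clm (S := S) i.1 (add_mul_div_mem_Icc i.2.2)
  refine ⟨_, inferInstance, φ, C, fun u => (h u).trans_eq ?_⟩
  simp only [hφ, Fintype.sum_prod_type, Finset.sum_range]
  rw [Finset.sum_coe_sort (Finset.Icc (-N : ℤ) N) fun n =>
    ∑ j : Fin m, ‖modeCoeff u n (S.b + j * ((S.d - S.b) / m))‖ ^ 2]

end GratingProblem

/-! ### Diagonal sesquilinear forms -/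

section DiagonalForm

variable {ι H : Type*} [SeminormedAddCommGroup H] [NormedSpace ℂ H] {φ : ι → H →L[ℂ] ℂ}
  {t t' : ι → ℂ}

/-- The sesquilinear form `∑ₙ tₙ φₙ(u) φₙ(v)̄` with symbol `t` in the coordinates `φ`. -/
def diagonalForm (φ : ι → H →L[ℂ] ℂ) (t : ι → ℂ) (u v : H) : ℂ :=
  ∑' n, t n * φ n u * conj (φ n v)

/-- The quadratic form `∑ₙ |tₙ| |φₙ(u)|²` is bounded; partial sums are used to avoid presupposing
convergence. Then `diagonalForm φ t` converges absolutely and is bounded. -/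
def IsBoundedSymbol (φ : ι → H →L[ℂ] ℂ) (t : ι → ℂ) : Prop :=
  ∃ K : NNReal, ∀ (u : H) (s : Finset ι), ∑ n ∈ s, ‖t n‖ * ‖φ n u‖ ^ 2 ≤ K * ‖u‖ ^ 2

namespace IsBoundedSymbol

theorem mono (ht : IsBoundedSymbol φ t) (h : ∀ n, ‖t' n‖ ≤ ‖t n‖) : IsBoundedSymbol φ t' := by
  obtain ⟨K, hK⟩ := ht
  exact ⟨K, fun u s => (Finset.sum_le_sum fun n _ => by gcongr; exact h n).trans (hK u s)⟩

theorem exists_sum_norm_mul_le (ht : IsBoundedSymbol φ t) : ∃ K : NNReal,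
    ∀ (u v : H) (s : Finset ι), ∑ n ∈ s, ‖t n * φ n u * conj (φ n v)‖ ≤ K * ‖u‖ * ‖v‖ := by
  obtain ⟨K, hK⟩ := ht
  refine ⟨K, fun u v s => le_of_sq_le_sq ?_ (by positivity)⟩
  have hterm : ∀ n, ‖t n * φ n u * conj (φ n v)‖
      = √‖t n‖ * ‖φ n u‖ * (√‖t n‖ * ‖φ n v‖) := fun n => by
    rw [norm_mul, norm_mul, RCLike.norm_conj, mul_mul_mul_comm, Real.mul_self_sqrt (norm_nonneg _),
      mul_assoc]
  calc (∑ n ∈ s, ‖t n * φ n u * conj (φ n v)‖) ^ 2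
      ≤ (∑ n ∈ s, ‖t n‖ * ‖φ n u‖ ^ 2) * ∑ n ∈ s, ‖t n‖ * ‖φ n v‖ ^ 2 := by
        have hcs := Finset.sum_mul_sq_le_sq_mul_sq s (fun n => √‖t n‖ * ‖φ n u‖)
          (fun n => √‖t n‖ * ‖φ n v‖)
        simpa only [hterm, mul_pow, Real.sq_sqrt (norm_nonneg _)] using hcs
    _ ≤ (K * ‖u‖ ^ 2) * (K * ‖v‖ ^ 2) := by
        gcongr
        exacts [hK u s, hK v s]
    _ = (K * ‖u‖ * ‖v‖) ^ 2 := by ring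

theorem summable (ht : IsBoundedSymbol φ t) (u v : H) :
    Summable fun n => t n * φ n u * conj (φ n v) := by
  obtain ⟨K, hK⟩ := ht.exists_sum_norm_mul_le
  exact .of_norm (summable_of_sum_le (fun _ => norm_nonneg _) (hK u v))

theorem diagonalForm_add (ht : IsBoundedSymbol φ t) (ht' : IsBoundedSymbol φ t') (u v : H) :
    diagonalForm φ (t + t') u v = diagonalForm φ t u v + diagonalForm φ t' u v := by
  simp only [diagonalForm, Pi.add_apply, add_mul]
  exact (ht.summable u v).tsum_add (ht'.summable u v)

theorem re_diagonalForm_self_nonpos (ht : IsBoundedSymbol φ t) (hre : ∀ n, (t n).re ≤ 0) (u : H) :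
    (diagonalForm φ t u u).re ≤ 0 := by
  rw [diagonalForm, Complex.re_tsum (ht.summable u u)]
  refine tsum_nonpos fun n => ?_
  rw [mul_assoc, Complex.mul_conj, Complex.re_mul_ofReal]
  exact mul_nonpos_of_nonpos_of_nonneg (hre n) (Complex.normSq_nonneg _)

theorem exists_clm_eq_diagonalForm (ht : IsBoundedSymbol φ t) :
    ∃ B : H →L[ℂ] H →L⋆[ℂ] ℂ, ∀ u v, diagonalForm φ t u v = B u v := by
  have hs := ht.summable
  obtain ⟨K, hK⟩ := ht.exists_sum_norm_mul_le
  refine ⟨(LinearMap.mk₂'ₛₗ (RingHom.id ℂ) (starRingEnd ℂ) (diagonalForm φ t)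
    (fun u u' v => ?_) (fun c u v => ?_) (fun u v v' => ?_) fun c u v => ?_).mkContinuous₂ K
    fun u v => ?_, fun _ _ => rfl⟩
  · simp only [diagonalForm, map_add, mul_add, add_mul, (hs u v).tsum_add (hs u' v)]
  · simp only [diagonalForm, map_smul, smul_eq_mul, RingHom.id_apply, ← tsum_mul_left]
    exact tsum_congr fun n => by ring
  · simp only [diagonalForm, map_add, mul_add, (hs u v).tsum_add (hs u v')]
  · simp only [diagonalForm, map_smul, smul_eq_mul, map_mul, ← tsum_mul_left]
    exact tsum_congr fun n => by ring
  · have hn := summable_of_sum_le (fun _ => norm_nonneg _) (hK u v)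
    exact (norm_tsum_le_tsum_norm hn).trans (hn.tsum_le_of_sum_le (hK u v))

end IsBoundedSymbol

theorem exists_isCompactOperator_eq_diagonalForm {s : Finset ι} (hs : ∀ n ∉ s, t n = 0)
    (φ : ι → H →L[ℂ] ℂ) : ∃ Q : H →L[ℂ] H →L⋆[ℂ] ℂ,
      (∀ u v, diagonalForm φ t u v = Q u v) ∧ IsCompactOperator Q := by
  let ψ : ι → H →L⋆[ℂ] ℂ := fun n => ((starL ℂ : ℂ ≃L⋆[ℂ] ℂ) : ℂ →L⋆[ℂ] ℂ).comp (φ n)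
  refine ⟨∑ n ∈ s, (t n • φ n).smulRight (ψ n), fun u v => ?_,
    Submodule.sum_mem (compactOperator (RingHom.id ℂ) H (H →L⋆[ℂ] ℂ)) fun n _ =>
      isCompactOperator_smulRight (t n • φ n) (ψ n)⟩
  rw [diagonalForm, tsum_eq_sum fun n hn => by rw [hs n hn, zero_mul, zero_mul], sum_apply,
    sum_apply]
  rfl

end DiagonalForm

theorem exists_mul_clm {X 𝕜 : Type*} [MeasurableSpace X] [RCLike 𝕜] {μ : Measure X} {ρ : X → 𝕜}
    (hρ : MemLp ρ ⊤ μ) : ∃ W : Lp 𝕜 2 μ →L[𝕜] Lp 𝕜 2 μ, ∀ f, W f =ᵐ[μ] fun x => ρ x * f x := by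
  refine ⟨(ContinuousLinearMap.mul 𝕜 𝕜).holderL μ ⊤ 2 2 hρ.toLp, fun f => ?_⟩
  filter_upwards [(ContinuousLinearMap.mul 𝕜 𝕜).coeFn_holder (r := 2) hρ.toLp f, hρ.coeFn_toLp]
    with x hx hρx
  rw [ContinuousLinearMap.holderL_apply_apply, hx, hρx, ContinuousLinearMap.mul_apply']

/-! ### The Dirichlet-to-Neumann maps as diagonal forms -/

namespace GratingProblem

variable {S : GratingProblem}

variable (S) in
/-- `topCoeff u n` as a bounded functional of `u`. -/
def topCoeffCLM (n : ℤ) : S.H1 →L[ℂ] ℂ :=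
  (exists_modeCoeff_clm n (Set.right_mem_Icc.2 S.b_lt_d.le)).choose

variable (S) in
/-- `bottomCoeff u n` as a bounded functional of `u`. -/
def bottomCoeffCLM (n : ℤ) : S.H1 →L[ℂ] ℂ :=
  (exists_modeCoeff_clm n (Set.left_mem_Icc.2 S.b_lt_d.le)).choose

theorem topCoeffCLM_apply (n : ℤ) (u : S.H1) : S.topCoeffCLM n u = topCoeff u n :=
  ((exists_modeCoeff_clm n (Set.right_mem_Icc.2 S.b_lt_d.le)).choose_spec u).trans
    (modeCoeff_d u n)

theorem bottomCoeffCLM_apply (n : ℤ) (u : S.H1) : S.bottomCoeffCLM n u = bottomCoeff u n :=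
  ((exists_modeCoeff_clm n (Set.left_mem_Icc.2 S.b_lt_d.le)).choose_spec u).trans
    (modeCoeff_b u n)

theorem isBoundedSymbol_of_isBigO {e : ℝ} (he : e ∈ Set.Icc S.b S.d) {φ : ℤ → S.H1 →L[ℂ] ℂ}
    (hφ : ∀ n u, φ n u = modeCoeff u n e) {t : ℤ → ℂ}
    (ht : t =O[cofinite] fun n => 1 + |S.α n|) : IsBoundedSymbol φ t := by
  obtain ⟨K, hK⟩ := S.exists_sum_mul_sq_norm_modeCoeff_le
  obtain ⟨M, hM, htM⟩ := Asymptotics.bound_of_isBigO_cofinite ht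
  refine ⟨(M * K).toNNReal, fun u s => ?_⟩
  calc ∑ n ∈ s, ‖t n‖ * ‖φ n u‖ ^ 2
      ≤ ∑ n ∈ s, M * ((1 + |S.α n|) * ‖modeCoeff u n e‖ ^ 2) := by
        refine Finset.sum_le_sum fun n _ => ?_
        have hpos : 0 < 1 + |S.α n| := by positivity
        have h := htM hpos.ne'
        rw [Real.norm_of_nonneg hpos.le] at h
        rw [hφ, ← mul_assoc]
        gcongr
    _ = M * ∑ n ∈ s, (1 + |S.α n|) * ‖modeCoeff u n e‖ ^ 2 := (Finset.mul_sum ..).symm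
    _ ≤ M * (K * ‖u‖ ^ 2) := mul_le_mul_of_nonneg_left (hK e he u s) hM.le
    _ ≤ (M * K).toNNReal * ‖u‖ ^ 2 := by
        rw [← mul_assoc]
        gcongr
        exact Real.le_coe_toNNReal _

theorem re_I_mul_β_nonpos (S : GratingProblem) (n : ℤ) : (Complex.I * S.β n).re ≤ 0 := by
  rw [β]
  split_ifs
  · simp
  · rw [← mul_assoc, Complex.I_mul_I, neg_one_mul, Complex.neg_re, Complex.ofReal_re]
    exact neg_nonpos.2 (Real.sqrt_nonneg _)

theorem sq_norm_β (S : GratingProblem) (n : ℤ) : ‖S.β n‖ ^ 2 = |S.k ^ 2 - S.α n ^ 2| := by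
  rw [β]
  split_ifs with h
  · rw [Complex.norm_real, Real.norm_eq_abs, sq_abs, Real.sq_sqrt (sub_nonneg.2 h),
      abs_of_nonneg (sub_nonneg.2 h)]
  · have h' := sub_nonneg.2 (not_le.1 h).le
    rw [norm_mul, Complex.norm_I, one_mul, Complex.norm_real, Real.norm_eq_abs, sq_abs,
      Real.sq_sqrt h', abs_sub_comm, abs_of_nonneg h']

theorem norm_β_le (S : GratingProblem) (n : ℤ) : ‖S.β n‖ ≤ (S.k + 1) * (1 + |S.α n|) := by
  have hk := S.k_pos
  refine le_of_sq_le_sq ?_ (by positivity)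
  have hα : 0 ≤ |S.α n| := abs_nonneg _
  have hle : S.k + |S.α n| ≤ (S.k + 1) * (1 + |S.α n|) := by nlinarith
  rw [sq_norm_β, ← sq_abs (S.α n)]
  refine (abs_le.2 ⟨?_, ?_⟩ : _ ≤ (S.k + |S.α n|) ^ 2).trans (by gcongr)
  · nlinarith
  · nlinarith

theorem isBoundedSymbol_β (S : GratingProblem) :
    IsBoundedSymbol S.topCoeffCLM fun n => Complex.I * S.β n := by
  refine isBoundedSymbol_of_isBigO (Set.right_mem_Icc.2 S.b_lt_d.le)
    (fun n u => (topCoeffCLM_apply n u).trans (modeCoeff_d u n).symm)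
    (.of_bound (S.k + 1) (.of_forall fun n => ?_))
  rw [norm_mul, Complex.norm_I, one_mul, Real.norm_of_nonneg (by positivity)]
  exact S.norm_β_le n

theorem exists_downwardCoefficient_neg (hb : ∀ n : ℤ, S.downwardMode n S.b ≠ 0) :
    ∃ N : ℕ, ∀ n : ℤ, (N : ℤ) < |n| → (S.downwardCoefficient n).im = 0 ∧
      (S.downwardCoefficient n).re < 0 ∧ -|S.α n| ≤ (S.downwardCoefficient n).re :=
  S.exists_hillPotential_neg.imp fun _ hN n hn =>
    downwardCoefficient_of_hillPotential_neg (hN n hn) (hb n)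

theorem isBoundedSymbol_downwardCoefficient (hb : ∀ n : ℤ, S.downwardMode n S.b ≠ 0) :
    IsBoundedSymbol S.bottomCoeffCLM S.downwardCoefficient := by
  obtain ⟨N, hN⟩ := exists_downwardCoefficient_neg hb
  refine isBoundedSymbol_of_isBigO (Set.left_mem_Icc.2 S.b_lt_d.le)
    (fun n u => (bottomCoeffCLM_apply n u).trans (modeCoeff_b u n).symm) (.of_bound 1 ?_)
  refine (Finset.Icc (-(N : ℤ)) N).eventually_cofinite_notMem.mono fun n hn => ?_
  obtain ⟨him, hneg, hle⟩ := hN n (not_le.1 fun h => hn (Finset.mem_Icc.2 (abs_le.1 h)))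
  rw [← Complex.abs_re_eq_norm.2 him, abs_of_neg hneg, one_mul,
    Real.norm_of_nonneg (by positivity)]
  linarith

theorem TminusHigh_apply (N : ℕ) (f : ℤ → ℂ) (n : ℤ) :
    S.TminusHigh N f n = S.TminusHigh N 1 n * f n := by
  simp only [TminusHigh, Tminus, Pi.one_apply, mul_one, ite_mul, zero_mul]

theorem TminusLow_apply (N : ℕ) (f : ℤ → ℂ) (n : ℤ) :
    S.TminusLow N f n = S.TminusLow N 1 n * f n := by
  simp only [TminusLow, Tminus, Pi.one_apply, mul_one, ite_mul, zero_mul]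

theorem TminusHigh_one_add_TminusLow_one (N : ℕ) :
    S.TminusHigh N 1 + S.TminusLow N 1 = S.downwardCoefficient := by
  ext n
  simp only [Pi.add_apply, TminusHigh, TminusLow, Tminus, Pi.one_apply, mul_one]
  split_ifs
  exacts [add_zero _, zero_add _]

theorem norm_TminusHigh_one_le (N : ℕ) (n : ℤ) :
    ‖S.TminusHigh N 1 n‖ ≤ ‖S.downwardCoefficient n‖ := by
  simp only [TminusHigh, Tminus, Pi.one_apply, mul_one]
  split_ifs <;> simp

theorem re_TminusHigh_one_nonpos {N : ℕ}
    (hN : ∀ n : ℤ, (N : ℤ) < |n| → (S.downwardCoefficient n).re ≤ 0) (n : ℤ) :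
    (S.TminusHigh N 1 n).re ≤ 0 := by
  simp only [TminusHigh, Tminus, Pi.one_apply, mul_one]
  split_ifs with hn
  exacts [hN n hn, le_rfl]

theorem norm_TminusLow_one_le (N : ℕ) (n : ℤ) :
    ‖S.TminusLow N 1 n‖ ≤ ‖S.downwardCoefficient n‖ := by
  simp only [TminusLow, Tminus, Pi.one_apply, mul_one]
  split_ifs <;> simp

theorem pairing_T (u v : S.H1) : S.pairing (S.T (topCoeff u)) (topCoeff v)
    = S.p * diagonalForm S.topCoeffCLM (fun n => Complex.I * S.β n) u v := by
  simp only [pairing, T, diagonalForm, topCoeffCLM_apply]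

theorem pairing_Tminus (u v : S.H1) : S.pairing (S.Tminus (bottomCoeff u)) (bottomCoeff v)
    = S.p * diagonalForm S.bottomCoeffCLM S.downwardCoefficient u v := by
  simp only [pairing, Tminus, diagonalForm, bottomCoeffCLM_apply]

theorem pairing_TminusHigh (N : ℕ) (u v : S.H1) :
    S.pairing (S.TminusHigh N (bottomCoeff u)) (bottomCoeff v)
      = S.p * diagonalForm S.bottomCoeffCLM (S.TminusHigh N 1) u v := by
  simp only [pairing, TminusHigh_apply N (bottomCoeff u), diagonalForm, bottomCoeffCLM_apply]

theorem pairing_TminusLow (N : ℕ) (u v : S.H1) :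
    S.pairing (S.TminusLow N (bottomCoeff u)) (bottomCoeff v)
      = S.p * diagonalForm S.bottomCoeffCLM (S.TminusLow N 1) u v := by
  simp only [pairing, TminusLow_apply N (bottomCoeff u), diagonalForm, bottomCoeffCLM_apply]

end GratingProblem

/-! ### Coercivity and compactness -/

namespace GratingProblem

theorem integral_gradient_eq_inner {S : GratingProblem} (u v : S.H1) :
    ∫ x in S.cell, (d₁ u x * conj (d₁ v x) + d₂ u x * conj (d₂ v x) + val u x * conj (val v x))
      = inner ℂ v u := by
  have h₀ := integrable_mul_conj (u.1 0) (v.1 0)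
  have h₁ := integrable_mul_conj (u.1 1) (v.1 1)
  have h₂ := integrable_mul_conj (u.1 2) (v.1 2)
  calc _ = (∫ x in S.cell, d₁ u x * conj (d₁ v x)) + (∫ x in S.cell, d₂ u x * conj (d₂ v x))
        + ∫ x in S.cell, val u x * conj (val v x) :=
        (integral_add (h₁.add h₂) h₀).trans (congrArg (· + _) (integral_add h₁ h₂))
    _ = inner ℂ (v.1 1) (u.1 1) + inner ℂ (v.1 2) (u.1 2) + inner ℂ (v.1 0) (u.1 0) := by
        simp only [inner_eq_integral, d₁, d₂, val]
    _ = inner ℂ v u := by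
        rw [Submodule.coe_inner, PiLp.inner_apply, Fin.sum_univ_three]
        ring

theorem memLp_weight (S : GratingProblem) :
    MemLp (fun x => (S.k : ℂ) ^ 2 * S.refractiveIndex x + 1) ⊤ (volume.restrict S.cell) := by
  have := S.cell_finite
  have hsub : S.cell ⊆ Set.univ ×ˢ Set.Ioo S.b S.d := fun x hx => ⟨trivial, hx.2⟩
  have hq₀ : MemLp S.q₀ ⊤ (volume.restrict S.cell) :=
    S.q₀_bounded.mono_measure (Measure.restrict_mono hsub le_rfl)
  refine ((hq₀.const_mul ((S.k : ℂ) ^ 2)).add (memLp_top_const 1)).ae_eq ?_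
  filter_upwards [ae_restrict_mem (measurableSet_Ioo.prod measurableSet_Ioo)] with x hx
  simp only [Pi.add_apply, refractiveIndex, if_neg (not_lt.2 hx.2.2.le), if_pos hx.2.1]

theorem isCompactForm_integral_mul {S : GratingProblem} {ρ : ℝ × ℝ → ℂ}
    (hρ : MemLp ρ ⊤ (volume.restrict S.cell)) :
    IsCompactForm fun u v : S.H1 => ∫ x in S.cell, ρ x * val u x * conj (val v x) := by
  obtain ⟨W, hW⟩ := exists_mul_clm hρ
  let B : S.L2 →L[ℂ] S.H1 →L⋆[ℂ] ℂ := (innerSLFlip ℂ).bilinearComp W (S.componentCLM 0)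
  refine ⟨B.comp (S.componentCLM 0), fun u v => ?_,
    S.isCompactOperator_componentCLM_zero.clm_comp B⟩
  calc ∫ x in S.cell, ρ x * val u x * conj (val v x)
      = ∫ x in S.cell, W (S.componentCLM 0 u) x * conj (S.componentCLM 0 v x) := by
        refine integral_congr_ae ?_
        filter_upwards [hW (S.componentCLM 0 u)] with x hx
        rw [hx]
        rfl
    _ = inner ℂ (S.componentCLM 0 v) (W (S.componentCLM 0 u)) := (inner_eq_integral ..).symm

variable {S : GratingProblem}

theorem principalForm_eq (N : ℕ) (u v : S.H1) : S.principalForm N u v = inner ℂ v u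
    - S.p * diagonalForm S.topCoeffCLM (fun n => Complex.I * S.β n) u v
    - S.p * diagonalForm S.bottomCoeffCLM (S.TminusHigh N 1) u v := by
  rw [principalForm, integral_gradient_eq_inner, pairing_T, pairing_TminusHigh]

theorem isCoerciveForm_principalForm (hτ : IsBoundedSymbol S.bottomCoeffCLM S.downwardCoefficient)
    {N : ℕ} (hN : ∀ n : ℤ, (N : ℤ) < |n| → (S.downwardCoefficient n).re ≤ 0) :
    IsCoerciveForm (S.principalForm N) := by
  have hβ := S.isBoundedSymbol_β
  have hhigh := hτ.mono (norm_TminusHigh_one_le N)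
  obtain ⟨B₁, hB₁⟩ := hβ.exists_clm_eq_diagonalForm
  obtain ⟨B₂, hB₂⟩ := hhigh.exists_clm_eq_diagonalForm
  refine ⟨⟨innerSLFlip ℂ - (S.p : ℂ) • B₁ - (S.p : ℂ) • B₂, fun u v => ?_⟩, 1, one_pos,
    fun u => ?_⟩
  · rw [principalForm_eq, hB₁, hB₂]
    rfl
  · have htop := hβ.re_diagonalForm_self_nonpos S.re_I_mul_β_nonpos u
    have hbottom := hhigh.re_diagonalForm_self_nonpos (re_TminusHigh_one_nonpos hN) u
    have hself : (inner ℂ u u : ℂ).re = ‖u‖ ^ 2 := inner_self_eq_norm_sq (𝕜 := ℂ) u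
    rw [principalForm_eq, Complex.sub_re, Complex.sub_re, Complex.re_ofReal_mul,
      Complex.re_ofReal_mul, hself]
    have hp := S.p_pos.le
    linarith [mul_nonpos_of_nonneg_of_nonpos hp htop, mul_nonpos_of_nonneg_of_nonpos hp hbottom]

theorem isCompactForm_lowerOrderForm (S : GratingProblem) (N : ℕ) :
    IsCompactForm (S.lowerOrderForm N) := by
  obtain ⟨Q₁, hQ₁, hc₁⟩ := isCompactForm_integral_mul S.memLp_weight
  have hlow : ∀ n ∉ Finset.Icc (-(N : ℤ)) N, S.TminusLow N 1 n = 0 := fun n hn =>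
    if_pos (not_le.1 fun h => hn (Finset.mem_Icc.2 (abs_le.1 h)))
  obtain ⟨Q₂, hQ₂, hc₂⟩ := exists_isCompactOperator_eq_diagonalForm hlow S.bottomCoeffCLM
  refine ⟨Q₁ + (S.p : ℂ) • Q₂, fun u v => ?_, hc₁.add (hc₂.smul (S.p : ℂ))⟩
  rw [lowerOrderForm, pairing_TminusLow, hQ₂]
  exact congrArg (· + _) (hQ₁ u v)

theorem integral_form_eq (u v : S.H1) :
    ∫ x in S.cell, (d₁ u x * conj (d₁ v x) + d₂ u x * conj (d₂ v x)
      - (S.k : ℂ) ^ 2 * S.refractiveIndex x * val u x * conj (val v x))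
      = (∫ x in S.cell, (d₁ u x * conj (d₁ v x) + d₂ u x * conj (d₂ v x)
          + val u x * conj (val v x)))
        - ∫ x in S.cell, ((S.k : ℂ) ^ 2 * S.refractiveIndex x + 1) * val u x * conj (val v x) := by
  have h₀ : Integrable (fun x => val u x * conj (val v x)) (volume.restrict S.cell) :=
    integrable_mul_conj (u.1 0) (v.1 0)
  have hgrad : Integrable (fun x => d₁ u x * conj (d₁ v x) + d₂ u x * conj (d₂ v x))
      (volume.restrict S.cell) :=
    (integrable_mul_conj (u.1 1) (v.1 1)).add (integrable_mul_conj (u.1 2) (v.1 2))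
  have hweight : Integrable (fun x => ((S.k : ℂ) ^ 2 * S.refractiveIndex x + 1) * val u x
      * conj (val v x)) (volume.restrict S.cell) := by
    simpa only [mul_assoc] using! h₀.mul_of_top_right S.memLp_weight
  refine Eq.trans ?_ (integral_sub (hgrad.add h₀) hweight)
  refine integral_congr_ae (ae_of_all _ fun x => ?_)
  ring

theorem form_eq_principalForm_sub_lowerOrderForm
    (hτ : IsBoundedSymbol S.bottomCoeffCLM S.downwardCoefficient) (N : ℕ) (u v : S.H1) :
    S.form u v = S.principalForm N u v - S.lowerOrderForm N u v := by
  have hsplit := (hτ.mono (norm_TminusHigh_one_le N)).diagonalForm_add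
    (hτ.mono (norm_TminusLow_one_le N)) u v
  rw [TminusHigh_one_add_TminusLow_one] at hsplit
  rw [form, principalForm, lowerOrderForm, integral_form_eq, pairing_Tminus, pairing_TminusHigh,
    pairing_TminusLow, hsplit]
  ring

theorem summable_T_mul_conj (u v : S.H1) :
    Summable fun n => S.T (topCoeff u) n * conj (topCoeff v n) := by
  simpa only [T, topCoeffCLM_apply] using S.isBoundedSymbol_β.summable u v

theorem summable_Tminus_mul_conj (hτ : IsBoundedSymbol S.bottomCoeffCLM S.downwardCoefficient)
    (u v : S.H1) : Summable fun n => S.Tminus (bottomCoeff u) n * conj (bottomCoeff v n) := by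
  simpa only [Tminus, bottomCoeffCLM_apply] using hτ.summable u v

end GratingProblem

end

theorem mainTheorem3_general (S : GratingProblem)
    (hb : ∀ n : ℤ, S.downwardMode n S.b ≠ 0) :
    (∀ u v : S.H1,
      Summable (fun n : ℤ => S.T (GratingProblem.topCoeff u) n
        * (starRingEnd ℂ) (GratingProblem.topCoeff v n)) ∧
      Summable (fun n : ℤ => S.Tminus (GratingProblem.bottomCoeff u) n
        * (starRingEnd ℂ) (GratingProblem.bottomCoeff v n))) ∧
    IsStronglyElliptic S.form ∧
    ∃ N : ℕ,
      (∀ n : ℤ, (N : ℤ) < |n| →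
        (S.downwardCoefficient n).im = 0 ∧ (S.downwardCoefficient n).re < 0) ∧
      IsCoerciveForm (S.principalForm N) ∧
      IsCompactForm (S.lowerOrderForm N) ∧
      ∀ u v : S.H1, S.form u v = S.principalForm N u v - S.lowerOrderForm N u v := by
  have hτ := GratingProblem.isBoundedSymbol_downwardCoefficient hb
  obtain ⟨N, hN⟩ := GratingProblem.exists_downwardCoefficient_neg hb
  have hcoercive := GratingProblem.isCoerciveForm_principalForm hτ fun n hn => (hN n hn).2.1.le
  have hcompact := S.isCompactForm_lowerOrderForm N
  have hsplit := GratingProblem.form_eq_principalForm_sub_lowerOrderForm hτ N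
  exact ⟨fun u v => ⟨GratingProblem.summable_T_mul_conj u v,
      GratingProblem.summable_Tminus_mul_conj hτ u v⟩,
    ⟨_, _, hcoercive, hcompact, hsplit⟩, N, fun n hn => ⟨(hN n hn).1, (hN n hn).2.1⟩,
    hcoercive, hcompact, hsplit⟩

theorem mainTheorem3 (S : GratingProblem) (hA : S.AssumptionA)
    (hb : ∀ n : ℤ, S.downwardMode n S.b ≠ 0) :
    (∀ u v : S.H1,
      Summable (fun n : ℤ => S.T (GratingProblem.topCoeff u) n
        * (starRingEnd ℂ) (GratingProblem.topCoeff v n)) ∧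
      Summable (fun n : ℤ => S.Tminus (GratingProblem.bottomCoeff u) n
        * (starRingEnd ℂ) (GratingProblem.bottomCoeff v n))) ∧
    IsStronglyElliptic S.form ∧
    ∃ N : ℕ,
      (∀ n : ℤ, (N : ℤ) < |n| →
        (S.downwardCoefficient n).im = 0 ∧ (S.downwardCoefficient n).re < 0) ∧
      IsCoerciveForm (S.principalForm N) ∧
      IsCompactForm (S.lowerOrderForm N) ∧
      ∀ u v : S.H1, S.form u v = S.principalForm N u v - S.lowerOrderForm N u v :=
  mainTheorem3_general S hb
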